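/- Let $\Bbbk$ be a commutative ring, let $\mathbf{gr}$ be the category of finitely generated free groups, and let $\mathcal{F}(\mathbf{gr};\Bbbk)$ be the abelian category of functors from $\mathbf{gr}$ to $\Bbbk$-modules, with the pointwise tensor product $\otimes=\otimes_{\Bbbk}$. Let $\mathfrak{a}\in\mathcal{F}(\mathbf{gr};\Bbbk)$ be the abelianization functor $G\mapsto (G/[G,G])\otimes_{\mathbb{Z}}\Bbbk$, and let $\bar P\in\mathcal{F}(\mathbf{gr};\Bbbk)$ be the reduced part of $G\mapsto\Bbbk[\mathbf{gr}(\mathbb{Z},G)]=\Bbbk[G]$, that is, the augmentation ideal of $\Bbbk[G]$. Let $\pi:\bar P\to\mathfrak{a}$ be the natural transformation with $\pi(g-1)=[g]$. The normalized bar resolution $$\cdots\to\bar P^{\otimes 3}\xrightarrow{d_2}\bar P^{\otimes 2}\xrightarrow{d_1}\bar P\xrightarrow{\pi}\mathfrak{a}\to 0,\qquad d_{r}(x_1\otimes\cdots\otimes x_{r+1})=\sum_{i=1}^{r}(-1)^i\,x_1\otimes\cdots\otimes x_ix_{i+1}\otimes\cdots\otimes x_{r+1},$$ is a projective resolution of $\mathfrak{a}$,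 with $\bar P^{\otimes r}$ in degree $r-1$. For $r\ge 1$ the morphism $\pi^{\otimes r}:\bar P^{\otimes r}\to\mathfrak{a}^{\otimes r}$ is a cocycle for it, and $[\pi^{\otimes r}]\in \mathrm{Ext}^{r-1}(\mathfrak{a},\mathfrak{a}^{\otimes r})$ denotes its class; all $\mathrm{Ext}$ groups are taken in $\mathcal{F}(\mathbf{gr};\Bbbk)$. For $n\ge 2$ let $[\pi^{\otimes 2}]\otimes[\mathrm{Id}_{\mathfrak{a}^{\otimes n-1}}]\in\mathrm{Ext}^1(\mathfrak{a}^{\otimes n},\mathfrak{a}^{\otimes n+1})$ be the exterior product of $[\pi^{\otimes 2}]\in\mathrm{Ext}^1(\mathfrak{a},\mathfrak{a}^{\otimes 2})$ and $[\mathrm{Id}_{\mathfrak{a}^{\otimes n-1}}]\in\mathrm{Ext}^0(\mathfrak{a}^{\otimes n-1},\mathfrak{a}^{\otimes n-1})$, with the usual identification $(\mathfrak{a}\otimes\mathfrak{a})\otimes\mathfrak{a}^{\otimes n-1}\cong\mathfrak{a}^{\otimes n+1}$. Let $\mathcal{Y}:\mathrm{Ext}^p(F,G)\otimes\mathrm{Ext}^q(G,H)\to\mathrm{Ext}^{p+q}(F,H)$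 be the Yoneda product, with the following sign convention: if $R_\bullet\to F$ and $S_\bullet\to G$ are projective resolutions, $f:R_p\to G$ and $g:S_q\to H$ are cocycles, and $\beta_k:R_{p+k}\to S_k$ $(k\ge 0)$ are morphisms that commute with the differentials (no signs) such that $\beta_0$ composed with the augmentation $S_0\to G$ is $f$, then $\mathcal{Y}([f],[g])=[g\circ\beta_q]$. Then for every $n\ge 2$ $$\mathcal{Y}\bigl([\pi^{\otimes n}],\,[\pi^{\otimes 2}]\otimes[\mathrm{Id}_{\mathfrak{a}^{\otimes n-1}}]\bigr)=[\pi^{\otimes n+1}]\quad\text{in }\mathrm{Ext}^{n}(\mathfrak{a},\mathfrak{a}^{\otimes n+1}).$$ -/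

import Mathlib

open CategoryTheory MonoidalCategory Limits
open scoped TensorProduct MonoidAlgebra
noncomputable section
namespace GrFunctor
universe w v u

section Yoneda
open CochainComplex CochainComplex.HomComplex Abelian

variable {C : Type u} [Category.{v} C] [Abelian C]

lemma equivHomShift_symm_f {K L : CochainComplex C ℤ} {p : ℤ} (b : Cocycle K L p) (i j : ℤ)
    (h : i + p = j) :
    (Cocycle.equivHomShift.symm b).f i = b.1.v i j h ≫ (L.shiftFunctorObjXIso p i j h.symm).inv := by
  rw [Cocycle.equivHomShift_symm_apply]
  simp [Cochain.rightShift_v _ _ _ _ i i (add_zero i) j h]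
  rfl

lemma equivHomShift_symm_comp {K L M : CochainComplex C ℤ} {p q r : ℤ} (b : Cocycle K L p)
    (c : Cocycle L M q) (z : Cocycle K M r) (h : p + q = r) (hz : z.1 = b.1.comp c.1 h) :
    ShiftedHom.comp (M := ℤ) (Cocycle.equivHomShift.symm b : K ⟶ L⟦p⟧)
      (Cocycle.equivHomShift.symm c : L ⟶ M⟦q⟧) (by lia) = (Cocycle.equivHomShift.symm z : K ⟶ M⟦r⟧) := by
  ext i
  rw [equivHomShift_symm_f z i (i + r) rfl, hz, Cochain.comp_v _ _ h i (i + p) (i + r) rfl (by lia)]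
  dsimp [ShiftedHom.comp]
  rw [equivHomShift_symm_f b i (i + p) rfl, equivHomShift_symm_f c (i + p) (i + r) (by lia),
    CochainComplex.shiftFunctorAdd'_inv_app_f']
  simp [CochainComplex.shiftFunctorObjXIso, HomologicalComplex.XIsoOfEq]
  erw [Category.comp_id, Category.comp_id, Category.assoc, eqToHom_trans, eqToHom_refl, Category.comp_id]

lemma shiftedHom_comp_aux {D : Type*} [Category D] [HasShift D ℤ] {X X' Y Y' Y'' Z Z' : D}
    {a b c : ℤ} (h : b + a = c)
    (α : ShiftedHom X X' (0 : ℤ)) (B : ShiftedHom X' Y a) (P : Y ⟶ Y') (γ : Y' ⟶ Y'') (α' : Y'' ⟶ Y)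
    (E : ShiftedHom Y Z b) (γ' : ShiftedHom Z Z' (0 : ℤ)) (h' : P ≫ γ ≫ α' = 𝟙 _) :
    (α.comp ((B.comp (.mk₀ _ rfl P) (zero_add _)).comp (.mk₀ (0 : ℤ) rfl γ) (zero_add _)) (add_zero _)).comp
      ((ShiftedHom.mk₀ (0 : ℤ) rfl α').comp (E.comp γ' (zero_add _)) (add_zero _)) h =
    α.comp ((B.comp E h).comp γ' (zero_add _)) (add_zero _) := by
  rw [ShiftedHom.comp_assoc B E γ' h (zero_add b) (by lia),
    ShiftedHom.comp_assoc α _ _ (add_zero _) h (by lia)]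
  congr 1
  rw [ShiftedHom.comp_assoc B _ _ (zero_add _) (zero_add (0:ℤ)) (by lia),
    ShiftedHom.comp_assoc B _ _ (zero_add _) (add_zero b) (by lia)]
  congr 1
  rw [← ShiftedHom.comp_assoc _ _ (E.comp γ' (zero_add _)) (zero_add _) (add_zero _) (by lia),
    ShiftedHom.mk₀_comp_mk₀, ShiftedHom.mk₀_comp_mk₀, Category.assoc, h',
    ShiftedHom.mk₀_id_comp]

variable {X Y : C} (R : ProjectiveResolution X) (S : ProjectiveResolution Y)

/-- The cochain whose component `R_{p+k} ⟶ S_k` is `(-1)^{pk} β_k`. -/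
def liftCochain {p : ℕ} (β : ∀ k : ℕ, R.complex.X (p + k) ⟶ S.complex.X k) :
    Cochain R.cochainComplex S.cochainComplex p :=
  Cochain.mk fun i j h =>
    if hj : j ≤ 0 then
      (p * j).negOnePow • ((R.cochainComplexXIso i (p + (-j).toNat) (by lia)).hom ≫
        β (-j).toNat ≫ (S.cochainComplexXIso j (-j).toNat (by lia)).inv)
    else 0

lemma liftCochain_v {p : ℕ} (β : ∀ k : ℕ, R.complex.X (p + k) ⟶ S.complex.X k) (i j : ℤ)
    (h : i + p = j) (k m : ℕ) (hk : - (k : ℤ) = j) (hm : p + k = m) :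
    (liftCochain R S β).v i j h = (p * j).negOnePow • ((R.cochainComplexXIso i m (by lia)).hom ≫
        (eqToHom (by rw [hm]) ≫ β k) ≫ (S.cochainComplexXIso j k (by lia)).inv) := by
  subst hm
  obtain rfl : k = (-j).toNat := by lia
  have hj : j ≤ 0 := by lia
  simp [liftCochain, hj]

lemma δ_liftCochain {p : ℕ} (β : ∀ k : ℕ, R.complex.X (p + k) ⟶ S.complex.X k)
    (hβ : ∀ k : ℕ, R.complex.d (p + k + 1) (p + k) ≫ β k = β (k + 1) ≫ S.complex.d (k + 1) k) :
    δ p (p + 1) (liftCochain R S β) = 0 := by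
  ext i j h
  rw [δ_v _ _ rfl _ _ _ _ (j - 1) (i + 1) rfl rfl, Cochain.zero_v]
  by_cases hj : j ≤ 0
  · obtain ⟨k, rfl⟩ := Int.exists_eq_neg_ofNat hj
    rw [liftCochain_v R S β i (-k - 1) (by lia) (k + 1) (p + k + 1) (by lia) (by lia),
      liftCochain_v R S β (i + 1) (-k) (by lia) k (p + k) (by lia) (by lia),
      R.cochainComplex_d i (i + 1) (p + k + 1) (p + k) (by lia) (by lia),
      S.cochainComplex_d (-k - 1) (-k) (k + 1) k (by lia) (by lia)]
    have e : ((p : ℤ) * (-k - 1)).negOnePow = - ((p + 1 : ℤ).negOnePow * (p * (-k) : ℤ).negOnePow) := by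
      rw [← Int.negOnePow_add, ← Int.negOnePow_succ, Int.negOnePow_eq_iff]
      ring_nf
      exact ⟨-1 - p, by ring⟩
    have := hβ k
    simp only [eqToHom_refl, Category.id_comp, Preadditive.comp_zsmul, Units.smul_def,
      Preadditive.zsmul_comp, Category.assoc, Iso.inv_hom_id_assoc, reassoc_of% this, e]
    simp [smul_smul]
  · exact (CochainComplex.isZero_of_isStrictlyLE _ 0 _).eq_of_tgt _ _

lemma toSingle_ext {K : CochainComplex C ℤ} {n : ℤ}
    {α α' : Cochain K ((singleFunctor C 0).obj Y) n} (i : ℤ) (h : i + n = 0)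
    (e : α.v i 0 h = α'.v i 0 h) : α = α' :=
  (Cochain.toSingleEquiv h).injective (by simp only [Cochain.toSingleEquiv]; exact congr($e ≫ _))

end Yoneda

section YonedaProduct
open CochainComplex CochainComplex.HomComplex Abelian

variable {C : Type u} [Category.{v} C] [Abelian C] [HasExt.{w} C]
  {X Y Z : C} (R : ProjectiveResolution X) (S : ProjectiveResolution Y)

lemma ext_comp_aux {p q r : ℕ} (h : p + q = r)
    (zf : Cocycle R.cochainComplex ((singleFunctor C 0).obj Y) p)
    (zg : Cocycle S.cochainComplex ((singleFunctor C 0).obj Z) q)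
    (z : Cocycle R.cochainComplex ((singleFunctor C 0).obj Z) r)
    (b : Cocycle R.cochainComplex S.cochainComplex p)
    (hb : zf = b.postcomp S.π') (hz : z.1 = b.1.comp zg.1 (by lia)) :
    (R.extEquivCohomologyClass.symm (.mk zf)).comp (S.extEquivCohomologyClass.symm (.mk zg)) h =
     R.extEquivCohomologyClass.symm (.mk z) := by
  have := HasDerivedCategory.standard C
  ext
  rw [Ext.comp_hom]
  simp only [ProjectiveResolution.extEquivCohomologyClass_symm_mk_hom]
  subst hb
  rw [← equivHomShift_symm_comp b zg z (by lia) hz, Cocycle.equivHomShift_symm_postcomp,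
    ← ShiftedHom.comp_mk₀ _ 0 rfl, ShiftedHom.map_comp, ShiftedHom.map_comp, ShiftedHom.map_mk₀]
  apply shiftedHom_comp_aux
  simp


lemma extMk_comp_extMk_aux {p q : ℕ} (f : R.complex.X p ⟶ Y) (hf : R.complex.d (p + 1) p ≫ f = 0)
    (g : S.complex.X q ⟶ Z) (hg : S.complex.d (q + 1) q ≫ g = 0)
    (β : ∀ k : ℕ, R.complex.X (p + k) ⟶ S.complex.X k) (h₀ : β 0 ≫ S.π.f 0 = f)
    (hβ : ∀ k : ℕ, R.complex.d (p + k + 1) (p + k) ≫ β k = β (k + 1) ≫ S.complex.d (k + 1) k)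
    (g' : R.complex.X (p + q) ⟶ Z) (hg' : (p * q : ℤ).negOnePow • (β q ≫ g) = g') :
    (R.extMk f (p + 1) rfl hf).comp (S.extMk g (q + 1) rfl hg) rfl =
      R.extMk g' (p + q + 1) rfl
        (by rw [← hg', Units.smul_def, Preadditive.comp_zsmul, reassoc_of% (hβ q), hg, comp_zero,
          smul_zero]) := by
  refine ext_comp_aux R S rfl _ _ _
    (Cocycle.mk (liftCochain R S β) _ rfl (δ_liftCochain R S β hβ)) ?_ ?_
  · ext : 1
    refine toSingle_ext (-(p : ℤ)) (by lia) ?_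
    rw [Cocycle.toSingleMk_coe, Cochain.toSingleMk_v, ← h₀]
    change _ = ((liftCochain R S β).comp (Cochain.ofHom S.π') (add_zero _)).v _ _ _
    rw [Cochain.comp_v _ _ _ _ 0 0 (by lia) (by lia), Cochain.ofHom_v,
      liftCochain_v R S β (-p) 0 (by lia) 0 p (by simp) rfl, ProjectiveResolution.π'_f_zero]
    simp only [mul_zero, Int.negOnePow_zero, one_smul, eqToHom_refl, Category.id_comp]
    erw [Category.assoc, Category.assoc, Category.assoc, Category.assoc, Iso.inv_hom_id_assoc]
    rfl
  · refine toSingle_ext (-((p + q : ℕ) : ℤ)) (by lia) ?_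
    rw [Cocycle.toSingleMk_coe, Cochain.toSingleMk_v, ← hg']
    change _ = ((liftCochain R S β).comp (Cochain.toSingleMk
      ((S.cochainComplexXIso (-q) q rfl).hom ≫ g) (by simp)) _).v _ _ _
    rw [Cochain.comp_v _ _ _ _ (-q) 0 (by lia) (by lia), Cochain.toSingleMk_v,
      liftCochain_v R S β _ (-q) (by lia) q (p + q) (by simp) rfl]
    simp only [mul_neg, Int.negOnePow_neg, eqToHom_refl, Category.id_comp, Units.smul_def,
      Category.assoc, Preadditive.zsmul_comp, Preadditive.comp_zsmul]
    erw [Preadditive.zsmul_comp, Category.assoc, Category.assoc, Iso.inv_hom_id_assoc]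
    rfl

/-- The Yoneda product `Ext^p(X, Y) ⊗ Ext^q(Y, Z) → Ext^{p+q}(X, Z)`, with the classical
convention of composing a cocycle with a lift to resolutions: if `x` is the class of the cocycle
`f : R_p ⟶ Y`, `y` is the class of the cocycle `g : S_q ⟶ Z`, and `β_k : R_{p+k} ⟶ S_k` is a lift
of `f` that commutes with the differentials, without signs, then the product is the class of
`g ∘ β_q`; see `yonedaProduct_extMk`. The composition `Ext.comp` of Mathlib is the composition in
the derived category, where a degree `p` cocycle of the morphism complex is
`(-1)^{pk} β_k`, hence the sign. -/
def yonedaProduct {p q n : ℕ} (x : Ext X Y p) (y : Ext Y Z q) (h : p + q = n) : Ext X Z n :=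
  (-1 : ℤ) ^ (p * q) • x.comp y h

/-- The Yoneda product of `[f]` and `[g]` is `[g ∘ β_q]`, for any lift `β` of `f`. -/
theorem yonedaProduct_extMk {p q : ℕ} (f : R.complex.X p ⟶ Y) (hf : R.complex.d (p + 1) p ≫ f = 0)
    (g : S.complex.X q ⟶ Z) (hg : S.complex.d (q + 1) q ≫ g = 0)
    (β : ∀ k : ℕ, R.complex.X (p + k) ⟶ S.complex.X k) (h₀ : β 0 ≫ S.π.f 0 = f)
    (hβ : ∀ k : ℕ, R.complex.d (p + k + 1) (p + k) ≫ β k = β (k + 1) ≫ S.complex.d (k + 1) k) :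
    yonedaProduct (R.extMk f (p + 1) rfl hf) (S.extMk g (q + 1) rfl hg) rfl =
      R.extMk (β q ≫ g) (p + q + 1) rfl (by rw [reassoc_of% (hβ q), hg, comp_zero]) := by
  have e : ((-1 : ℤ) ^ (p * q)) = (((p * q : ℤ).negOnePow : ℤˣ) : ℤ) := by
    simp [← Int.coe_negOnePow_natCast]
  rw [yonedaProduct, extMk_comp_extMk_aux R S f hf g hg β h₀ hβ _ rfl, e]
  obtain h | h := Int.even_or_odd (p * q : ℤ)
  · simp [Int.negOnePow_even _ h]
  · simp [Int.negOnePow_odd _ h, ProjectiveResolution.neg_extMk]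

end YonedaProduct

section GroupLevel
variable (k : Type u) [CommRing k] (G : Type) [Group G]

/-- The augmentation `k[G] → k`, `g ↦ 1`. -/
def aug : MonoidAlgebra k G →ₐ[k] k := MonoidAlgebra.lift k k G 1

/-- The augmentation ideal of `k[G]`, as a `k`-module. -/
abbrev AugIdeal : Submodule k (MonoidAlgebra k G) := LinearMap.ker (aug k G).toLinearMap

/-- `(G/[G,G]) ⊗_ℤ k`. -/
abbrev AbTensor : Type u := k ⊗[ℤ] (Additive (Abelianization G))

variable {k G} in
/-- The class of `g` in `(G/[G,G]) ⊗ k`. -/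
def abClass (g : G) : AbTensor k G := 1 ⊗ₜ[ℤ] Additive.ofMul (Abelianization.of g)

/-- The linear map `k[G] → (G/[G,G]) ⊗ k` that sends `g` to its class. -/
def toAb : MonoidAlgebra k G →ₗ[k] AbTensor k G :=
  (Finsupp.linearCombination k (abClass (k := k) (G := G))).comp
    (MonoidAlgebra.coeffLinearEquiv k).toLinearMap

end GroupLevel

section Fox
variable {k : Type u} [CommRing k] {G : Type} [Group G]

/-- The action of `G` on the multiplicative version of a representation. -/
def repMulAut {V : Type u} [AddCommGroup V] [Module k V]
    (ρ : Representation k G V) : G →* MulAut (Multiplicative V) where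
  toFun g :=
    { toFun := fun v => Multiplicative.ofAdd (ρ g v.toAdd)
      invFun := fun v => Multiplicative.ofAdd (ρ g⁻¹ v.toAdd)
      left_inv := fun v => by simp
      right_inv := fun v => by simp
      map_mul' := fun v w => by simp }
  map_one' := by ext; simp
  map_mul' g h := by ext; simp

lemma exists_crossedHom [IsFreeGroup G] {V : Type u} [AddCommGroup V] [Module k V]
    (ρ : Representation k G V) (f : IsFreeGroup.Generators G → V) :
    ∃ δ : G → V, (∀ s, δ (IsFreeGroup.of s) = f s) ∧
      ∀ g h, δ (g * h) = δ g + ρ g (δ h) := by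
  let Φ : G →* Multiplicative V ⋊[repMulAut ρ] G :=
    IsFreeGroup.lift fun s => ⟨Multiplicative.ofAdd (f s), IsFreeGroup.of s⟩
  have hr : SemidirectProduct.rightHom.comp Φ = MonoidHom.id G := by
    apply IsFreeGroup.ext_hom
    intro a
    simp [Φ]
  have hr' (g : G) : (Φ g).right = g := DFunLike.congr_fun hr g
  refine ⟨fun g => (Φ g).left.toAdd, fun s => by simp [Φ], fun g h => ?_⟩
  change (Φ (g * h)).left.toAdd = _
  rw [map_mul, SemidirectProduct.mul_left, hr']
  rfl

/-- A crossed homomorphism with values in a representation of a free group is determined by its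
values on generators. -/
lemma crossedHom_unique [IsFreeGroup G] {V : Type u} [AddCommGroup V] [Module k V]
    (ρ : Representation k G V) (δ δ' : G → V)
    (h : ∀ s, δ (IsFreeGroup.of s) = δ' (IsFreeGroup.of s))
    (h1 : ∀ g h, δ (g * h) = δ g + ρ g (δ h)) (h2 : ∀ g h, δ' (g * h) = δ' g + ρ g (δ' h)) :
    δ = δ' := by
  have mk (δ : G → V) (h1 : ∀ g h, δ (g * h) = δ g + ρ g (δ h)) :
      ∃ Φ : G →* Multiplicative V ⋊[repMulAut ρ] G,
        ∀ g, Φ g = ⟨Multiplicative.ofAdd (δ g), g⟩ :=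
    ⟨MonoidHom.mk' (fun g => ⟨Multiplicative.ofAdd (δ g), g⟩) (fun a b => by
      apply SemidirectProduct.ext
      · rw [SemidirectProduct.mul_left, h1]
        rfl
      · rfl), fun g => rfl⟩
  obtain ⟨Φ, hΦ⟩ := mk δ h1
  obtain ⟨Φ', hΦ'⟩ := mk δ' h2
  have e : Φ = Φ' := by
    apply IsFreeGroup.ext_hom
    intro a
    rw [hΦ, hΦ', h]
  funext g
  have := congrArg SemidirectProduct.left (DFunLike.congr_fun e g)
  rw [hΦ, hΦ'] at this
  exact this

@[simp] lemma aug_single (g : G) (r : k) : aug k G (.single g r) = r := by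
  simp [aug, MonoidAlgebra.lift_single]

@[simp] lemma toAb_single (g : G) (r : k) :
    toAb k G (.single g r) = r • abClass g := by
  simp [toAb, MonoidAlgebra.coeffLinearEquiv]

/-- The product of the augmentation ideal. -/
def augMul : AugIdeal k G ⊗[k] AugIdeal k G →ₗ[k] AugIdeal k G :=
  TensorProduct.lift (LinearMap.mk₂ k
    (fun x y => (⟨x.1 * y.1, by
      have := y.2; simp only [LinearMap.mem_ker, AlgHom.toLinearMap_apply] at this ⊢
      rw [map_mul, this, mul_zero]⟩ : AugIdeal k G))
    (fun x x' y => Subtype.ext (add_mul _ _ _)) (fun c x y => Subtype.ext (smul_mul_assoc _ _ _))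
    (fun x y y' => Subtype.ext (mul_add _ _ _)) (fun c x y => Subtype.ext (mul_smul_comm _ _ _)))

@[simp] lemma augMul_tmul (x y : AugIdeal k G) : (augMul (x ⊗ₜ y)).1 = x.1 * y.1 := rfl

/-- `x ↦ x - ε(x)`. -/
def augProj : MonoidAlgebra k G →ₗ[k] AugIdeal k G :=
  LinearMap.codRestrict _ (LinearMap.id - (Algebra.linearMap k _).comp (aug k G).toLinearMap)
    (fun x => by simp)

lemma augProj_coe (x : MonoidAlgebra k G) :
    (augProj x).1 = x - algebraMap k _ (aug k G x) := rfl

lemma augProj_mem (x : AugIdeal k G) : augProj x.1 = x := by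
  apply Subtype.ext
  have := x.2
  simp only [LinearMap.mem_ker, AlgHom.toLinearMap_apply] at this
  rw [augProj_coe, this]; simp

lemma exists_fox [IsFreeGroup G] :
    ∃ (D : AugIdeal k G →ₗ[k] AugIdeal k G ⊗[k] AugIdeal k G)
      (v : AugIdeal k G →ₗ[k] AugIdeal k G),
      (∀ x, augMul (D x) = x - v x) ∧
      (∀ x y, D (augMul (x ⊗ₜ y)) =
        LinearMap.rTensor _ (augMul.comp (TensorProduct.mk k _ _ x)) (D y) + x ⊗ₜ v y) ∧
      (∀ x : AugIdeal k G, toAb k G x.1 = 0 → v x = 0) := by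
  let A := MonoidAlgebra k G
  let I := AugIdeal k G
  let lm (a : A) : A ⊗[k] I →ₗ[k] A ⊗[k] I := LinearMap.rTensor I (LinearMap.mulLeft k a)
  have lm_mul (a b : A) : lm (a * b) = (lm a).comp (lm b) := by
    apply TensorProduct.ext'
    intro x y
    simp [lm]
  have lm_one : lm 1 = LinearMap.id := by
    apply TensorProduct.ext'
    intro x y
    simp [lm]
  let ρ : Representation k G (A ⊗[k] I) :=
    { toFun := fun g => lm (.single g 1)
      map_one' := lm_one
      map_mul' := fun g h => by
        rw [← one_mul (1 : k), ← MonoidAlgebra.single_mul_single, lm_mul]; simp; rfl }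
  let gen (g : G) : I := augProj (.single g 1)
  obtain ⟨δ, hδ, hδm⟩ := exists_crossedHom ρ (fun s => (1 : A) ⊗ₜ[k] gen (IsFreeGroup.of s))
  have δ_one : δ 1 = 0 := by
    have := hδm 1 1
    simpa using this
  let Δ : A →ₗ[k] A ⊗[k] I :=
    (Finsupp.linearCombination k δ).comp (MonoidAlgebra.coeffLinearEquiv k).toLinearMap
  have Δ_single (g : G) (r : k) : Δ (.single g r) = r • δ g := by
    change Finsupp.linearCombination k δ (Finsupp.single g r) = _
    simp
  have lm_add (a b : A) : lm (a + b) = lm a + lm b := by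
    apply TensorProduct.ext'
    intro x y
    simp [lm, add_mul, TensorProduct.add_tmul]
  have lm_smul (r : k) (a : A) : lm (r • a) = r • lm a := by
    apply TensorProduct.ext'
    intro x y
    simp [lm, TensorProduct.smul_tmul']
  have lm_zero : lm 0 = 0 := by simpa using lm_smul 0 0
  have Δ_mul (x y : A) : Δ (x * y) = aug k G y • Δ x + lm x (Δ y) := by
    induction x using MonoidAlgebra.induction_linear with
    | zero => simp [lm_zero]
    | add x x' hx hx' =>
      rw [add_mul, map_add, hx, hx', lm_add, map_add, smul_add, LinearMap.add_apply]; abel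
    | single g r =>
      induction y using MonoidAlgebra.induction_linear with
      | zero => simp
      | add y y' hy hy' => rw [mul_add, map_add, hy, hy', map_add, add_smul, map_add, map_add]; abel
      | single h t =>
        have e : (MonoidAlgebra.single g r : A) = r • .single g 1 := by simp
        rw [MonoidAlgebra.single_mul_single, Δ_single, Δ_single, Δ_single, hδm, aug_single, e,
          lm_smul]
        change (r * t) • (δ g + lm _ (δ h)) = _
        rw [LinearMap.smul_apply, map_smul, smul_add, smul_smul, smul_smul, mul_comm t r]
  let ev : A ⊗[k] I →ₗ[k] A := TensorProduct.lift ((LinearMap.mul k A).compl₂ I.subtype)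
  have ev_tmul (a : A) (i : I) : ev (a ⊗ₜ i) = a * i.1 := rfl
  have ev_lm (a : A) (z : A ⊗[k] I) : ev (lm a z) = a * ev z := by
    induction z using TensorProduct.induction_on with
    | zero => simp
    | tmul x y => simp [lm, ev_tmul, mul_assoc]
    | add x y hx hy => rw [map_add, map_add, hx, hy, map_add, mul_add]
  let ρA : Representation k G A :=
    { toFun := fun g => LinearMap.mulLeft k (.single g 1)
      map_one' := LinearMap.ext fun x => one_mul x
      map_mul' := fun g h => by
        apply LinearMap.ext
        intro x
        change MonoidAlgebra.single (g * h) 1 * x = .single g 1 * (.single h 1 * x)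
        rw [← mul_assoc, MonoidAlgebra.single_mul_single, one_mul] }
  have ev_δ (g : G) : ev (δ g) = .single g 1 - 1 := by
    refine congrFun (crossedHom_unique ρA (fun g => ev (δ g)) (fun g => .single g 1 - 1) ?_ ?_ ?_) g
    · intro s
      rw [hδ, ev_tmul, one_mul, augProj_coe, aug_single, map_one]
    · intro g h
      change ev (δ _) = ev (δ _) + _ * ev (δ _)
      rw [hδm, map_add]
      exact congrArg _ (ev_lm _ _)
    · intro g h
      change (MonoidAlgebra.single (g * h) 1 - 1 : A) = _ + MonoidAlgebra.single g 1 * (MonoidAlgebra.single h 1 - 1)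
      rw [mul_sub, MonoidAlgebra.single_mul_single]
      simp
  have ev_Δ (x : A) : ev (Δ x) = x - algebraMap k A (aug k G x) := by
    induction x using MonoidAlgebra.induction_linear with
    | zero => simp
    | add x y hx hy => simp only [map_add, hx, hy]; abel
    | single g r =>
      rw [Δ_single, map_smul, ev_δ, aug_single, smul_sub, Algebra.algebraMap_eq_smul_one]
      congr 1
      exact (MonoidAlgebra.smul_single' r g 1).trans (by rw [mul_one])
  let E : A ⊗[k] I →ₗ[k] I :=
    (TensorProduct.lid k I).toLinearMap.comp (LinearMap.rTensor I (aug k G).toLinearMap)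
  have E_tmul (a : A) (i : I) : E (a ⊗ₜ i) = aug k G a • i := by simp [E]
  have E_lm (a : A) (z : A ⊗[k] I) : E (lm a z) = aug k G a • E z := by
    induction z using TensorProduct.induction_on with
    | zero => simp
    | tmul x y => simp [lm, E_tmul, mul_smul]
    | add x y hx hy => rw [map_add, map_add, hx, hy, map_add, smul_add]
  refine ⟨(LinearMap.rTensor I augProj).comp (Δ.comp I.subtype), E.comp (Δ.comp I.subtype),
    ?_, ?_, ?_⟩
  · intro x
    have key (z : A ⊗[k] I) : (augMul (LinearMap.rTensor I augProj z)).1 = ev z - (E z).1 := by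
      induction z using TensorProduct.induction_on with
      | zero => simp
      | tmul a i =>
        rw [LinearMap.rTensor_tmul, augMul_tmul, ev_tmul, E_tmul, augProj_coe, sub_mul,
          Submodule.coe_smul, Algebra.smul_def]
      | add x y hx hy =>
        rw [map_add, map_add, Submodule.coe_add, hx, hy, map_add, map_add, Submodule.coe_add]; abel
    apply Subtype.ext
    have hx : aug k G x.1 = 0 := x.2
    refine (key _).trans ?_
    have := ev_Δ x.1
    rw [hx, map_zero, sub_zero] at this
    rw [Submodule.coe_sub]
    exact congrArg (· - _) this
  · intro x y
    have hx : aug k G x.1 = 0 := x.2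
    have hy : aug k G y.1 = 0 := y.2
    have key (z : A ⊗[k] I) : LinearMap.rTensor I augProj (lm x.1 z) =
        LinearMap.rTensor I (augMul.comp (TensorProduct.mk k _ _ x))
          (LinearMap.rTensor I augProj z) + x ⊗ₜ E z := by
      induction z using TensorProduct.induction_on with
      | zero => simp
      | tmul a i =>
        simp only [lm, LinearMap.rTensor_tmul, E_tmul, TensorProduct.tmul_smul]
        rw [TensorProduct.smul_tmul', ← TensorProduct.add_tmul]
        congr 1
        apply Subtype.ext
        change (augProj (x.1 * a)).1 = x.1 * (augProj a).1 + (aug k G a) • x.1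
        rw [augProj_coe, augProj_coe, map_mul, hx, Algebra.smul_def, mul_sub,
          Algebra.commutes]
        simp
      | add z w hz hw =>
        rw [map_add, map_add, hz, hw]; simp only [map_add, TensorProduct.tmul_add]; abel
    change LinearMap.rTensor I augProj (Δ (x.1 * y.1)) = _
    rw [Δ_mul, hy, zero_smul, zero_add]
    exact key _
  · let w : G →* Multiplicative I := MonoidHom.mk' (fun g => Multiplicative.ofAdd (E (δ g)))
      (fun g h => by
        rw [hδm]
        change _ = Multiplicative.ofAdd (_ + _)
        rw [map_add]
        congr 2
        refine (E_lm _ _).trans ?_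
        rw [aug_single, one_smul]; rfl)
    let w' : AbTensor k G →ₗ[k] I := TensorProduct.AlgebraTensorModule.lift
      (LinearMap.toSpanSingleton k _
        ((MonoidHom.toAdditiveLeft (Abelianization.lift w)).toIntLinearMap))
    have key (x : A) : w' (toAb k G x) = E (Δ x) := by
      induction x using MonoidAlgebra.induction_linear with
      | zero => simp
      | add x y hx hy => simp only [map_add, hx, hy]
      | single g r =>
        rw [toAb_single, Δ_single, map_smul, map_smul]
        congr 1
        simp [abClass, w', w]
    intro x hx
    change E (Δ x.1) = 0
    rw [← key, hx, map_zero]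
end Fox

/-- The category of finitely generated free groups. -/
abbrev Gr := ObjectProperty.FullSubcategory
  (fun G : GrpCat.{0} => IsFreeGroup G ∧ Group.FG G)

variable (k : Type u) [CommRing k]

/-- The category of functors from finitely generated free groups to `k`-modules. -/
abbrev FGr := Gr ⥤ ModuleCat.{u} k

variable {k} in
lemma aug_map {G H : Type} [Group G] [Group H] (f : G →* H) (x : MonoidAlgebra k G) :
    aug k H (MonoidAlgebra.mapDomainAlgHom k k f x) = aug k G x := by
  induction x using MonoidAlgebra.induction_linear with
  | zero => simp
  | add x y hx hy => simp only [map_add, hx, hy]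
  | single g r => simp

/-- The linear map induced on augmentation ideals by a group homomorphism. -/
def augIdealMap {G H : Type} [Group G] [Group H] (f : G →* H) :
    AugIdeal k G →ₗ[k] AugIdeal k H :=
  LinearMap.restrict (MonoidAlgebra.mapDomainAlgHom k k f).toLinearMap
    (fun x hx => (aug_map f x).trans hx)

lemma augIdealMap_coe {G H : Type} [Group G] [Group H] (f : G →* H) (x : AugIdeal k G) :
    (augIdealMap k f x).1 = MonoidAlgebra.mapDomainAlgHom k k f x.1 := rfl

/-- The linear map induced by a group homomorphism on abelianizations tensored with `k`. -/
def abTensorMap {G H : Type} [Group G] [Group H] (f : G →* H) :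
    AbTensor k G →ₗ[k] AbTensor k H :=
  LinearMap.baseChange k (MonoidHom.toAdditive (Abelianization.map f)).toIntLinearMap

lemma abTensorMap_abClass {G H : Type} [Group G] [Group H] (f : G →* H) (g : G) :
    abTensorMap k f (abClass g) = abClass (f g) := rfl

/-- The abelianization functor `𝔞`, `G ↦ (G/[G,G]) ⊗ k`. -/
def ab : FGr k where
  obj G := ModuleCat.of k (AbTensor k G.obj)
  map f := ModuleCat.ofHom (abTensorMap k f.hom.hom)
  map_id G := by
    ext1
    apply TensorProduct.AlgebraTensorModule.curry_injective
    apply LinearMap.ext_ring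
    ext x
    induction x with | _ x
    induction x using QuotientGroup.induction_on
    rfl
  map_comp f g := by
    ext1
    apply TensorProduct.AlgebraTensorModule.curry_injective
    apply LinearMap.ext_ring
    ext x
    induction x with | _ x
    induction x using QuotientGroup.induction_on
    rfl

/-- The functor `P̄`: the reduced part of `G ↦ k[G] = k[Hom(ℤ, G)]`, i.e. the augmentation
ideal. -/
def barP : FGr k where
  obj G := ModuleCat.of k (AugIdeal k G.obj)
  map f := ModuleCat.ofHom (augIdealMap k f.hom.hom)
  map_id G := by
    apply ModuleCat.hom_ext
    apply LinearMap.ext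
    intro x
    apply Subtype.ext
    exact DFunLike.congr_fun (MonoidAlgebra.mapDomainAlgHom_id (R := k) (A := k)) x.1
  map_comp f g := by
    apply ModuleCat.hom_ext
    apply LinearMap.ext
    intro x
    apply Subtype.ext
    exact DFunLike.congr_fun (MonoidAlgebra.mapDomainAlgHom_comp (R := k) (A := k)
      f.hom.hom g.hom.hom) x.1

variable {k} in
lemma toAb_map {G H : Type} [Group G] [Group H] (f : G →* H) (x : MonoidAlgebra k G) :
    toAb k H (MonoidAlgebra.mapDomainAlgHom k k f x) = abTensorMap k f (toAb k G x) := by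
  induction x using MonoidAlgebra.induction_linear with
  | zero => simp
  | add x y hx hy => rw [map_add, map_add, hx, hy, map_add, map_add]
  | single g r =>
    rw [toAb_single, map_smul, abTensorMap_abClass]
    simp

/-- The natural transformation `π : P̄ ⟶ 𝔞`, `g - 1 ↦ [g]`. -/
def barPToAb : barP k ⟶ ab k where
  app G := ModuleCat.ofHom ((toAb k G.obj).comp (AugIdeal k G.obj).subtype)
  naturality G H f := by
    ext x
    exact toAb_map _ _

/-- The product `P̄ ⊗ P̄ ⟶ P̄` of the augmentation ideal. -/
def barPMul : barP k ⊗ barP k ⟶ barP k where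
  app G := ModuleCat.ofHom augMul
  naturality G H f := by
    ext1
    apply TensorProduct.ext'
    intro x y
    apply Subtype.ext
    exact (map_mul (MonoidAlgebra.mapDomainAlgHom k k f.hom.hom) x.1 y.1).symm

variable {k} in
/-- Tensor powers: `tpow F n = F ⊗ (F ⊗ (⋯ ⊗ F))` with `n` factors. -/
def tpow (F : FGr k) : ℕ → FGr k
  | 0 => 𝟙_ _
  | 1 => F
  | n + 2 => F ⊗ tpow F (n + 1)

/-- The natural transformation `π^{⊗ n} : P̄^{⊗ n} ⟶ 𝔞^{⊗ n}`. -/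
def piPow : (n : ℕ) → (tpow (barP k) n ⟶ tpow (ab k) n)
  | 0 => 𝟙 _
  | 1 => barPToAb k
  | n + 2 => barPToAb k ⊗ₘ piPow (n + 1)

/-- Multiplication of the first two factors, `P̄^{⊗ (n+2)} ⟶ P̄^{⊗ (n+1)}`. -/
def mulFirst : (n : ℕ) → (tpow (barP k) (n + 2) ⟶ tpow (barP k) (n + 1))
  | 0 => barPMul k
  | n + 1 => (α_ (barP k) (barP k) (tpow (barP k) (n + 1))).inv ≫
      barPMul k ▷ tpow (barP k) (n + 1)

variable {k} in
/-- Tensoring on the left with the identity of `P̄`. -/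
def idTensor {n m : ℕ} (f : tpow (barP k) (n + 1) ⟶ tpow (barP k) (m + 1)) :
    tpow (barP k) (n + 2) ⟶ tpow (barP k) (m + 2) := barP k ◁ f

/-- The differential of the normalized bar complex,
`x₁ ⊗ ⋯ ⊗ xₙ₊₂ ↦ ∑_{i=1}^{n+1} (-1)^i x₁ ⊗ ⋯ ⊗ xᵢ xᵢ₊₁ ⊗ ⋯ ⊗ xₙ₊₂`. -/
def barD : (n : ℕ) → (tpow (barP k) (n + 2) ⟶ tpow (barP k) (n + 1))
  | 0 => - mulFirst k 0
  | n + 1 => - mulFirst k (n + 1) - idTensor (barD n)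


section Elements

variable {k} {G : Gr}

/-- The pure tensor `x ⊗ u` in a tensor power. -/
def tm {n : ℕ} (x : AugIdeal k G.obj) (u : (tpow (barP k) (n + 1)).obj G) :
    (tpow (barP k) (n + 2)).obj G := TensorProduct.tmul k (M := AugIdeal k G.obj) x u

lemma tm_zero {n : ℕ} (x : AugIdeal k G.obj) :
    tm x (0 : (tpow (barP k) (n + 1)).obj G) = 0 := TensorProduct.tmul_zero _ _

lemma tm_add {n : ℕ} (x : AugIdeal k G.obj) (u v : (tpow (barP k) (n + 1)).obj G) :
    tm x (u + v) = tm x u + tm x v := TensorProduct.tmul_add _ _ _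

lemma tm_neg {n : ℕ} (x : AugIdeal k G.obj) (u : (tpow (barP k) (n + 1)).obj G) :
    tm x (-u) = -tm x u := TensorProduct.tmul_neg _ _

lemma tm_sub {n : ℕ} (x : AugIdeal k G.obj) (u v : (tpow (barP k) (n + 1)).obj G) :
    tm x (u - v) = tm x u - tm x v := TensorProduct.tmul_sub _ _ _

lemma tm_smul {n : ℕ} (c : k) (x : AugIdeal k G.obj) (u : (tpow (barP k) (n + 1)).obj G) :
    tm x (c • u) = c • tm x u :=
  TensorProduct.tmul_smul (R := k) (M := AugIdeal k G.obj) (N := (tpow (barP k) (n + 1)).obj G) c x u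

lemma tm_induction {n : ℕ} {p : (tpow (barP k) (n + 2)).obj G → Prop} (h0 : p 0)
    (h : ∀ x u, p (tm x u)) (hadd : ∀ a b, p a → p b → p (a + b)) (z) : p z :=
  TensorProduct.induction_on (R := k) (M := (barP k).obj G) (N := (tpow (barP k) (n + 1)).obj G) z h0 h hadd

variable (G) in
/-- The differential at `G`, as a linear map. -/
abbrev dAt (n : ℕ) : (tpow (barP k) (n + 2)).obj G →ₗ[k] (tpow (barP k) (n + 1)).obj G :=
  ((barD k n).app G).hom

variable (G) in
/-- The multiplication of the first two factors at `G`, as a linear map. -/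
abbrev mfAt (n : ℕ) : (tpow (barP k) (n + 2)).obj G →ₗ[k] (tpow (barP k) (n + 1)).obj G :=
  ((mulFirst k n).app G).hom

lemma mfAt_zero (x y : AugIdeal k G.obj) :
    mfAt G 0 (tm (n := 0) x y) = (augMul (x ⊗ₜ y) : AugIdeal k G.obj) := rfl

lemma mfAt_succ {n : ℕ} (x y : AugIdeal k G.obj) (u : (tpow (barP k) (n + 1)).obj G) :
    mfAt G (n + 1) (tm x (tm y u)) = tm (augMul (x ⊗ₜ y)) u := rfl

lemma dAt_zero (z) : dAt (k := k) G 0 z = - mfAt G 0 z := rfl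

lemma dAt_succ {n : ℕ} (x : AugIdeal k G.obj) (u : (tpow (barP k) (n + 2)).obj G) :
    dAt G (n + 1) (tm x u) = - mfAt G (n + 1) (tm x u) - tm x (dAt G n u) := rfl

lemma augMul_assoc (x y z : AugIdeal k G.obj) :
    augMul (x ⊗ₜ augMul (y ⊗ₜ z)) = augMul (augMul (x ⊗ₜ y) ⊗ₜ z) :=
  Subtype.ext (mul_assoc _ _ _).symm

lemma mfAt_assoc {n : ℕ} (x y : AugIdeal k G.obj) (u : (tpow (barP k) (n + 1)).obj G) :
    mfAt G n (tm x (mfAt G n (tm y u))) = mfAt G n (tm (augMul (x ⊗ₜ y)) u) := by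
  cases n with
  | zero => exact augMul_assoc x y u
  | succ n =>
    induction u using tm_induction with
    | h0 =>
      have h (x : AugIdeal k G.obj) :
        tm x (0 : (tpow (barP k) (n + 2)).obj G) = 0 := TensorProduct.tmul_zero _ _
      simp only [h, map_zero]
    | h z u => rw [mfAt_succ, mfAt_succ, mfAt_succ, augMul_assoc]
    | hadd a b ha hb => simp only [tm_add, map_add, ha, hb]

lemma dAt_dAt (n : ℕ) (z : (tpow (barP k) (n + 3)).obj G) : dAt G n (dAt G (n + 1) z) = 0 := by
  induction n with
  | zero =>
    induction z using tm_induction with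
    | h0 => simp only [map_zero]
    | h x u =>
      induction u using tm_induction with
      | h0 => rw [tm_zero]; simp only [map_zero]
      | h y w =>
        rw [dAt_succ, map_sub, map_neg, dAt_zero, dAt_zero, dAt_zero, tm_neg, map_neg, mfAt_succ,
          mfAt_assoc]
        abel
      | hadd a b ha hb => simp only [tm_add, map_add, ha, hb, add_zero]
    | hadd a b ha hb => simp only [map_add, ha, hb, add_zero]
  | succ n ih =>
    induction z using tm_induction with
    | h0 => simp only [map_zero]
    | h x u =>
      induction u using tm_induction with
      | h0 => rw [tm_zero]; simp only [map_zero]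
      | h y w =>
        rw [dAt_succ, map_sub, map_neg, mfAt_succ, dAt_succ, dAt_succ, ih, dAt_succ, tm_sub,
          tm_neg, map_sub, map_neg, mfAt_assoc, mfAt_succ]
        rw [tm_zero]
        abel
      | hadd a b ha hb => simp only [tm_add, map_add, ha, hb, add_zero]
    | hadd a b ha hb => simp only [map_add, ha, hb, add_zero]

variable (G) in
/-- The extension of a map `P̄(G) → P̄(G)^{⊗ 2}` to tensor powers by acting on the last factor. -/
def homot (D : AugIdeal k G.obj →ₗ[k] AugIdeal k G.obj ⊗[k] AugIdeal k G.obj) :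
    (n : ℕ) → ((tpow (barP k) (n + 1)).obj G →ₗ[k] (tpow (barP k) (n + 2)).obj G)
  | 0 => D
  | n + 1 => LinearMap.lTensor (AugIdeal k G.obj) (homot D n)

lemma homot_succ (D : AugIdeal k G.obj →ₗ[k] AugIdeal k G.obj ⊗[k] AugIdeal k G.obj) (n : ℕ)
    (x : AugIdeal k G.obj) (u) : homot G D (n + 1) (tm x u) = tm x (homot G D n u) := rfl

lemma homot_mf (D : AugIdeal k G.obj →ₗ[k] AugIdeal k G.obj ⊗[k] AugIdeal k G.obj) (n : ℕ)
    (x : AugIdeal k G.obj) (u) :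
    mfAt G (n + 2) (tm x (homot G D (n + 1) u)) = homot G D (n + 1) (mfAt G (n + 1) (tm x u)) := by
  induction u using tm_induction with
  | h0 =>
    have h (n : ℕ) (x : AugIdeal k G.obj) :
      tm x (0 : (tpow (barP k) (n + 1)).obj G) = 0 := TensorProduct.tmul_zero _ _
    simp only [h, map_zero]
  | h y w => rfl
  | hadd a b ha hb => simp only [tm_add, map_add, ha, hb]

lemma mfAt_one (x : AugIdeal k G.obj) (w : AugIdeal k G.obj ⊗[k] AugIdeal k G.obj) :
    mfAt G 1 (tm (n := 1) x w) =
      LinearMap.rTensor _ (augMul.comp (TensorProduct.mk k _ _ x)) w := by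
  induction w using TensorProduct.induction_on with
  | zero =>
    have h : tm (n := 1) x (0 : AugIdeal k G.obj ⊗[k] AugIdeal k G.obj) = 0 :=
      TensorProduct.tmul_zero _ _
    exact (congrArg (mfAt G 1) h).trans ((map_zero _).trans (map_zero _).symm)
  | tmul a b => rfl
  | add a b ha hb =>
    rw [map_add, ← ha, ← hb]
    exact (congrArg (mfAt G 1) (tm_add (n := 1) x a b)).trans (map_add (mfAt G 1) _ _)

lemma homotopy_zero (D : AugIdeal k G.obj →ₗ[k] AugIdeal k G.obj ⊗[k] AugIdeal k G.obj)
    (v : AugIdeal k G.obj →ₗ[k] AugIdeal k G.obj)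
    (h1 : ∀ x, augMul (D x) = x - v x)
    (h2 : ∀ x y, D (augMul (x ⊗ₜ y)) =
        LinearMap.rTensor _ (augMul.comp (TensorProduct.mk k _ _ x)) (D y) + x ⊗ₜ v y)
    (x y : AugIdeal k G.obj) :
    dAt G 1 (homot G D 1 (tm (n := 0) x y)) - homot G D 0 (dAt G 0 (tm (n := 0) x y)) =
      (-1 : k) ^ 0 • tm (n := 0) x y := by
  have a1 : dAt G 0 (homot G D 0 y) = v y - y := by
    change -(augMul (D y)) = _
    rw [h1, neg_sub]
  have a2 : homot G D 0 (dAt G 0 (tm (n := 0) x y)) =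
      -(mfAt G 1 (tm (n := 1) x (D y)) + tm (n := 0) x (v y)) := by
    refine (map_neg D _).trans (congrArg _ ((h2 x y).trans ?_))
    rw [mfAt_one]
    rfl
  have a3 : dAt G 1 (homot G D 1 (tm (n := 0) x y)) =
      -mfAt G 1 (tm (n := 1) x (D y)) - (tm (n := 0) x (v y) - tm (n := 0) x y) :=
    congrArg (fun t => -mfAt G 1 (tm (n := 1) x (D y)) - t)
      ((congrArg (tm (n := 0) x) a1).trans (tm_sub (n := 0) x (v y) y))
  rw [a2, a3, pow_zero, one_smul]
  abel

lemma homotopy (D : AugIdeal k G.obj →ₗ[k] AugIdeal k G.obj ⊗[k] AugIdeal k G.obj)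
    (v : AugIdeal k G.obj →ₗ[k] AugIdeal k G.obj)
    (h1 : ∀ x, augMul (D x) = x - v x)
    (h2 : ∀ x y, D (augMul (x ⊗ₜ y)) =
        LinearMap.rTensor _ (augMul.comp (TensorProduct.mk k _ _ x)) (D y) + x ⊗ₜ v y)
    (n : ℕ) (z : (tpow (barP k) (n + 2)).obj G) :
    dAt G (n + 1) (homot G D (n + 1) z) - homot G D n (dAt G n z) = (-1 : k) ^ n • z := by
  induction n with
  | zero =>
    induction z using tm_induction with
    | h0 => simp only [map_zero, smul_zero]; exact sub_zero _
    | h x y =>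
      exact homotopy_zero D v h1 h2 x y
    | hadd a b ha hb =>
      rw [smul_add, ← ha, ← hb]; simp only [map_add]; abel
  | succ n ih =>
    induction z using tm_induction with
    | h0 => simp only [map_zero, smul_zero, sub_zero]
    | h x u =>
      rw [homot_succ, dAt_succ, dAt_succ, homot_mf, map_sub, map_neg, homot_succ, pow_succ,
        mul_neg, mul_one, neg_smul, ← tm_smul, ← ih, tm_sub]
      abel
    | hadd a b ha hb =>
      rw [smul_add, ← ha, ← hb]; simp only [map_add]; abel

lemma barD_exactAt (n : ℕ) (z : (tpow (barP k) (n + 2)).obj G) (hz : dAt G n z = 0) :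
    ∃ w, dAt G (n + 1) w = z := by
  have := G.property.1
  obtain ⟨D, v, h1, h2, -⟩ := exists_fox (k := k) (G := G.obj)
  have := homotopy D v h1 h2 n z
  rw [hz, map_zero, sub_zero] at this
  refine ⟨(-1 : k) ^ n • homot G D (n + 1) z, ?_⟩
  rw [map_smul, this, smul_smul, ← mul_pow]
  simp

lemma toAb_augMul (z : AugIdeal k G.obj ⊗[k] AugIdeal k G.obj) :
    toAb k G.obj (augMul z).1 = 0 := by
  have h (x y : MonoidAlgebra k G.obj) :
      toAb k G.obj (x * y) = aug k _ y • toAb k _ x + aug k _ x • toAb k _ y := by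
    induction x using MonoidAlgebra.induction_linear with
    | zero => simp
    | add x x' hx hx' => simp only [add_mul, map_add, hx, hx', smul_add, add_smul]; abel
    | single g r =>
      induction y using MonoidAlgebra.induction_linear with
      | zero => simp
      | add y y' hy hy' => simp only [mul_add, map_add, hy, hy', smul_add, add_smul]; abel
      | single h t =>
        rw [MonoidAlgebra.single_mul_single, toAb_single, toAb_single, toAb_single, aug_single,
          aug_single, show abClass (k := k) (g * h) = abClass g + abClass h by
            simp [abClass, TensorProduct.tmul_add], smul_add, smul_smul, smul_smul, mul_comm t r]
  induction z using TensorProduct.induction_on with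
  | zero => simp
  | tmul x y =>
    have hx : aug k G.obj x.1 = 0 := x.2
    have hy : aug k G.obj y.1 = 0 := y.2
    rw [augMul_tmul, h, hx, hy, zero_smul, zero_smul, add_zero]
  | add a b ha hb => rw [map_add, Submodule.coe_add, map_add, ha, hb, add_zero]

lemma barPToAb_exactAt (x : AugIdeal k G.obj) (hx : toAb k G.obj x.1 = 0) :
    ∃ w, dAt G 0 w = x := by
  have := G.property.1
  obtain ⟨D, v, h1, h2, h3⟩ := exists_fox (k := k) (G := G.obj)
  refine ⟨-(homot G D 0 x), ?_⟩
  rw [map_neg, dAt_zero, neg_neg]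
  exact (h1 x).trans (by rw [h3 x hx, sub_zero])

lemma toAb_surjective (y : AbTensor k G.obj) : ∃ x : AugIdeal k G.obj, toAb k G.obj x.1 = y := by
  induction y using TensorProduct.induction_on with
  | zero => exact ⟨0, by simp⟩
  | add a b ha hb =>
    obtain ⟨x, hx⟩ := ha
    obtain ⟨y, hy⟩ := hb
    exact ⟨x + y, by rw [Submodule.coe_add, map_add, hx, hy]⟩
  | tmul r a =>
    induction a with | _ a
    induction a using QuotientGroup.induction_on with | _ g
    refine ⟨augProj (.single g r), ?_⟩
    have h1 : toAb k G.obj (algebraMap k _ r) = 0 := by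
      rw [Algebra.algebraMap_eq_smul_one, MonoidAlgebra.one_def, map_smul, toAb_single]
      simp [abClass]
    rw [augProj_coe, aug_single, map_sub, h1, sub_zero, toAb_single]
    simp [abClass, TensorProduct.smul_tmul']
    rfl

end Elements


section Projectivity

variable {k}

/-- The free group on `n` generators as an object of `Gr`. -/
def freeGr (n : ℕ) : Gr := ⟨GrpCat.of (FreeGroup (Fin n)), inferInstance, inferInstance⟩

/-- The morphism from the free group on `n` generators given by `n` elements. -/
def freeGrLift {n : ℕ} {G : Gr} (g : Fin n → G.obj) : freeGr n ⟶ G :=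
  ObjectProperty.homMk (GrpCat.ofHom (FreeGroup.lift g))

/-- The generators of the free group on `n` generators. -/
def freeGrGen (n : ℕ) : Fin n → (freeGr n).obj := FreeGroup.of

lemma freeGrLift_gen {n : ℕ} {G : Gr} (g : Fin n → G.obj) (i : Fin n) :
    (freeGrLift g).hom.hom (freeGrGen n i) = g i := FreeGroup.lift_apply_of

lemma freeGrLift_comp {n : ℕ} {G H : Gr} (g : Fin n → G.obj) (f : G ⟶ H) :
    freeGrLift g ≫ f = freeGrLift (fun i => f.hom.hom (g i)) := by
  apply ObjectProperty.hom_ext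
  apply GrpCat.hom_ext
  apply FreeGroup.ext_hom
  intro i
  change f.hom.hom ((freeGrLift g).hom.hom (freeGrGen n i)) =
    (freeGrLift (fun i => f.hom.hom (g i))).hom.hom (freeGrGen n i)
  rw [freeGrLift_gen, freeGrLift_gen]

/-- A functor with natural bases `G ↦ G^n` is projective. -/
lemma projective_of_basis {n : ℕ} (F : FGr k)
    (b : ∀ G : Gr, Module.Basis (Fin n → G.obj) k (F.obj G))
    (hb : ∀ {G H : Gr} (f : G ⟶ H) (g : Fin n → G.obj),
      (F.map f).hom (b G g) = b H (fun i => f.hom.hom (g i))) : Projective F where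
  factors {E X} φ e he := by
    have hs (G : Gr) : Function.Surjective (e.app G).hom :=
      (ModuleCat.epi_iff_surjective _).1 ((NatTrans.epi_iff_epi_app e).1 he G)
    obtain ⟨y, hy⟩ := hs (freeGr n) ((φ.app (freeGr n)).hom (b _ (freeGrGen n)))
    have hgen {G : Gr} (g : Fin n → G.obj) :
        (F.map (freeGrLift g)).hom (b _ (freeGrGen n)) = b G g := by
      rw [hb]
      congr 1
      funext i
      exact freeGrLift_gen g i
    have nat {A B : FGr k} (τ : A ⟶ B) {G H : Gr} (f : G ⟶ H) (a : A.obj G) :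
        (τ.app H).hom ((A.map f).hom a) = (B.map f).hom ((τ.app G).hom a) :=
      DFunLike.congr_fun (congrArg ModuleCat.Hom.hom (τ.naturality f)) a
    let ψ : F ⟶ E :=
      { app := fun G => ModuleCat.ofHom ((b G).constr k fun g => (E.map (freeGrLift g)).hom y)
        naturality := fun G H f => by
          apply ModuleCat.hom_ext
          apply (b G).ext
          intro g
          change ((b H).constr k _) ((F.map f).hom (b G g)) =
            (E.map f).hom ((b G).constr k _ (b G g))
          rw [hb, Module.Basis.constr_basis, Module.Basis.constr_basis, ← freeGrLift_comp,
            E.map_comp]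
          rfl }
    refine ⟨ψ, ?_⟩
    ext1
    funext G
    apply ModuleCat.hom_ext
    apply (b G).ext
    intro g
    change (e.app G).hom ((b G).constr k _ (b G g)) = (φ.app G).hom (b G g)
    rw [Module.Basis.constr_basis, ← hgen g, nat, nat, hy]

variable (k) in
/-- The functor `G ↦ k[G]`. -/
def groupAlg : FGr k where
  obj G := ModuleCat.of k (MonoidAlgebra k G.obj)
  map f := ModuleCat.ofHom (MonoidAlgebra.mapDomainAlgHom k k f.hom.hom).toLinearMap
  map_id G := by
    apply ModuleCat.hom_ext
    apply LinearMap.ext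
    intro x
    exact DFunLike.congr_fun (MonoidAlgebra.mapDomainAlgHom_id (R := k) (A := k)) x
  map_comp f g := by
    apply ModuleCat.hom_ext
    apply LinearMap.ext
    intro x
    exact DFunLike.congr_fun (MonoidAlgebra.mapDomainAlgHom_comp (R := k) (A := k)
      f.hom.hom g.hom.hom) x

lemma exists_basis_tensor {ι κ : Gr → Type} (X Y : FGr k)
    (mι : ∀ {G H : Gr}, (G ⟶ H) → ι G → ι H) (mκ : ∀ {G H : Gr}, (G ⟶ H) → κ G → κ H)
    (b : ∀ G : Gr, Module.Basis (ι G) k (X.obj G)) (c : ∀ G : Gr, Module.Basis (κ G) k (Y.obj G))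
    (hb : ∀ {G H : Gr} (f : G ⟶ H) (g : ι G), (X.map f).hom (b G g) = b H (mι f g))
    (hc : ∀ {G H : Gr} (f : G ⟶ H) (g : κ G), (Y.map f).hom (c G g) = c H (mκ f g)) :
    ∃ d : ∀ G : Gr, Module.Basis (ι G × κ G) k ((X ⊗ Y).obj G),
      ∀ {G H : Gr} (f : G ⟶ H) (p : ι G × κ G),
        ((X ⊗ Y).map f).hom (d G p) = d H (mι f p.1, mκ f p.2) := by
  refine ⟨fun G => (b G).tensorProduct (c G), fun {G H} f p => ?_⟩
  refine (congrArg ((X ⊗ Y).map f).hom (Module.Basis.tensorProduct_apply _ _ _ _)).trans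
    (Eq.trans ?_ (Module.Basis.tensorProduct_apply _ _ _ _).symm)
  rw [← hb, ← hc]
  rfl

lemma exists_basis_reindex {ι κ : Gr → Type} (X : FGr k)
    (mι : ∀ {G H : Gr}, (G ⟶ H) → ι G → ι H) (mκ : ∀ {G H : Gr}, (G ⟶ H) → κ G → κ H)
    (b : ∀ G : Gr, Module.Basis (ι G) k (X.obj G))
    (hb : ∀ {G H : Gr} (f : G ⟶ H) (g : ι G), (X.map f).hom (b G g) = b H (mι f g))
    (e : ∀ G, κ G ≃ ι G) (he : ∀ {G H : Gr} (f : G ⟶ H) g, mι f (e G g) = e H (mκ f g)) :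
    ∃ d : ∀ G : Gr, Module.Basis (κ G) k (X.obj G),
      ∀ {G H : Gr} (f : G ⟶ H) (p : κ G), (X.map f).hom (d G p) = d H (mκ f p) := by
  refine ⟨fun G => (b G).reindex (e G).symm, fun {G H} f p => ?_⟩
  rw [Module.Basis.reindex_apply, Module.Basis.reindex_apply, hb]
  simp [he]

lemma exists_basis_groupAlg (n : ℕ) :
    ∃ b : ∀ G : Gr, Module.Basis (Fin (n + 1) → G.obj) k ((tpow (groupAlg k) (n + 1)).obj G),
      ∀ {G H : Gr} (f : G ⟶ H) (g : Fin (n + 1) → G.obj),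
        ((tpow (groupAlg k) (n + 1)).map f).hom (b G g) = b H (fun i => f.hom.hom (g i)) := by
  have b1 : ∃ b : ∀ G : Gr, Module.Basis G.obj k ((groupAlg k).obj G),
      ∀ (G : Gr) (g : G.obj), b G g = MonoidAlgebra.single g (1 : k) :=
    ⟨fun G => ⟨MonoidAlgebra.coeffLinearEquiv k⟩, fun G g => rfl⟩
  obtain ⟨b1, hb1⟩ := b1
  have hm {G H : Gr} (f : G ⟶ H) (g : G.obj) :
      ((groupAlg k).map f).hom (b1 G g) = b1 H (f.hom.hom g) := by
    rw [hb1, hb1]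
    exact MonoidAlgebra.mapDomain_single
  induction n with
  | zero =>
    exact exists_basis_reindex (groupAlg k) (fun f g => f.hom.hom g)
      (fun f g i => f.hom.hom (g i)) b1 hm (fun G => Equiv.funUnique (Fin 1) G.obj)
      (fun f g => rfl)
  | succ n ih =>
    obtain ⟨b, hb⟩ := ih
    obtain ⟨d, hd⟩ := exists_basis_tensor _ _ (fun f g => f.hom.hom g)
      (fun f g i => f.hom.hom (g i)) b1 b hm hb
    exact exists_basis_reindex (groupAlg k ⊗ tpow (groupAlg k) (n + 1)) _
      (fun f g i => f.hom.hom (g i)) d hd (fun G => (Fin.consEquiv fun _ => G.obj).symm)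
      (fun f g => rfl)

lemma augProj_map {G H : Type} [Group G] [Group H] (f : G →* H) (x : MonoidAlgebra k G) :
    augProj (MonoidAlgebra.mapDomainAlgHom k k f x) = augIdealMap k f (augProj x) := by
  apply Subtype.ext
  rw [augIdealMap_coe, augProj_coe, augProj_coe, map_sub, AlgHom.commutes, aug_map]

/-- Tensor powers of a natural transformation. -/
def tpowMap {F F' : FGr k} (φ : F ⟶ F') : (n : ℕ) → (tpow F n ⟶ tpow F' n)
  | 0 => 𝟙 _
  | 1 => φ
  | n + 2 => φ ⊗ₘ tpowMap φ (n + 1)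

lemma tpowMap_comp {F F' F'' : FGr k} (φ : F ⟶ F') (ψ : F' ⟶ F'') (n : ℕ) :
    tpowMap φ (n + 1) ≫ tpowMap ψ (n + 1) = tpowMap (φ ≫ ψ) (n + 1) := by
  induction n with
  | zero => rfl
  | succ n ih => exact (tensorHom_comp_tensorHom _ _ _ _).trans (by rw [ih]; rfl)

lemma tpowMap_id (F : FGr k) (n : ℕ) : tpowMap (𝟙 F) (n + 1) = 𝟙 _ := by
  induction n with
  | zero => rfl
  | succ n ih => exact (congrArg _ ih).trans (id_tensorHom_id _ _)

instance projective_tpow_barP (n : ℕ) : Projective (tpow (barP k) (n + 1)) := by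
  obtain ⟨b, hb⟩ := exists_basis_groupAlg (k := k) n
  have := projective_of_basis _ b hb
  let i : barP k ⟶ groupAlg k :=
    { app := fun G => ModuleCat.ofHom (AugIdeal k G.obj).subtype
      naturality := fun G H f => rfl }
  let r : groupAlg k ⟶ barP k :=
    { app := fun G => ModuleCat.ofHom augProj
      naturality := fun G H f => by
        apply ModuleCat.hom_ext
        apply LinearMap.ext
        intro x
        exact augProj_map _ _ }
  have hir : i ≫ r = 𝟙 _ := by
    ext1
    funext G
    apply ModuleCat.hom_ext
    apply LinearMap.ext
    intro x
    exact augProj_mem x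
  let R : Retract (tpow (barP k) (n + 1)) (tpow (groupAlg k) (n + 1)) :=
    { i := tpowMap i (n + 1)
      r := tpowMap r (n + 1)
      retract := by rw [tpowMap_comp, hir, tpowMap_id] }
  exact R.projective

end Projectivity


section Resolution

lemma barD_comp (n : ℕ) : barD k (n + 1) ≫ barD k n = 0 := by
  ext1
  funext G
  apply ModuleCat.hom_ext
  apply LinearMap.ext
  intro z
  exact dAt_dAt n z

lemma barD_comp_pi : barD k 0 ≫ barPToAb k = 0 := by
  ext1
  funext G
  apply ModuleCat.hom_ext
  apply LinearMap.ext
  intro z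
  change toAb k G.obj (-(augMul z) : AugIdeal k G.obj).1 = 0
  rw [Submodule.coe_neg, map_neg]
  exact neg_eq_zero.2 (toAb_augMul z)

/-- The normalized bar complex `⋯ ⟶ P̄^{⊗ 3} ⟶ P̄^{⊗ 2} ⟶ P̄`. -/
def barComplex : ChainComplex (FGr k) ℕ :=
  ChainComplex.of (fun n => tpow (barP k) (n + 1)) (barD k) (barD_comp k)

variable {k} in
lemma exact_of_pointwise (S : ShortComplex (FGr k))
    (h : ∀ (G : Gr) (x : S.X₂.obj G), (S.g.app G).hom x = 0 → ∃ y, (S.f.app G).hom y = x) :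
    S.Exact := by
  rw [ShortComplex.exact_iff_isZero_homology, Functor.isZero_iff]
  intro G
  refine IsZero.of_iso ?_ (S.mapHomologyIso ((evaluation Gr (ModuleCat.{u} k)).obj G)).symm
  rw [← ShortComplex.exact_iff_isZero_homology, ShortComplex.moduleCat_exact_iff]
  exact h G

lemma barComplex_d (n : ℕ) : (barComplex k).d (n + 1) n = barD k n :=
  by simp [barComplex]

lemma exact_barD (n : ℕ) : (ShortComplex.mk _ _ (barD_comp k n)).Exact :=
  exact_of_pointwise _ fun _ x hx => barD_exactAt n x hx

lemma exact_barD_pi : (ShortComplex.mk _ _ (barD_comp_pi k)).Exact :=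
  exact_of_pointwise _ fun _ x hx => barPToAb_exactAt x hx

instance : Epi (barPToAb k) := by
  rw [NatTrans.epi_iff_epi_app]
  intro G
  rw [ModuleCat.epi_iff_surjective]
  exact fun y => toAb_surjective y

/-- The augmentation of the normalized bar complex, given by `π : P̄ ⟶ 𝔞` in degree `0`. -/
def barAug : barComplex k ⟶ (ChainComplex.single₀ (FGr k)).obj (ab k) :=
  (ChainComplex.toSingle₀Equiv (barComplex k) (ab k)).symm ⟨barPToAb k, by
    rw [barComplex_d]; exact barD_comp_pi k⟩

lemma barAug_f_zero : (barAug k).f 0 = barPToAb k :=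
  ChainComplex.toSingle₀Equiv_symm_apply_f_zero (C := barComplex k) (barPToAb k) _

/-- The normalized bar resolution of the abelianization functor. -/
def barResolution : ProjectiveResolution (ab k) where
  complex := barComplex k
  projective n := inferInstanceAs (Projective (tpow (barP k) (n + 1)))
  π := barAug k
  quasiIso := ⟨fun n => by
    cases n
    · rw [ChainComplex.quasiIsoAt₀_iff, ShortComplex.quasiIso_iff_of_zeros']
      · refine (ShortComplex.exact_and_epi_g_iff_of_iso ?_).2
          ⟨exact_barD_pi k, inferInstanceAs (Epi (barPToAb k))⟩
        exact ShortComplex.isoMk (Iso.refl _) (Iso.refl _) (Iso.refl _)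
          ((Category.id_comp _).trans ((barComplex_d k 0).symm.trans (Category.comp_id _).symm))
          ((Category.id_comp _).trans ((barAug_f_zero k).symm.trans (Category.comp_id _).symm))
      all_goals rfl
    · rw [quasiIsoAt_iff_exactAt']
      · rename_i n
        rw [HomologicalComplex.exactAt_iff' _ (n + 1 + 1) (n + 1) n (by simp) (by simp)]
        refine (ShortComplex.exact_iff_of_iso ?_).2 (exact_barD k n)
        exact ShortComplex.isoMk (Iso.refl _) (Iso.refl _) (Iso.refl _)
          ((Category.id_comp _).trans ((barComplex_d k (n + 1)).symm.trans (Category.comp_id _).symm))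
          ((Category.id_comp _).trans ((barComplex_d k n).symm.trans (Category.comp_id _).symm))
      · apply ChainComplex.exactAt_succ_single_obj⟩

lemma barD_piPow (n : ℕ) : barD k n ≫ piPow k (n + 1) = 0 := by
  induction n with
  | zero => exact barD_comp_pi k
  | succ n ih =>
    ext1
    funext G
    apply ModuleCat.hom_ext
    apply LinearMap.ext
    intro z
    have key (x : AugIdeal k G.obj) (w : (tpow (barP k) (n + 1)).obj G) :
        ((piPow k (n + 2)).app G).hom (tm x w) =
          TensorProduct.tmul k (M := AbTensor k G.obj) (toAb k G.obj x.1)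
            (((piPow k (n + 1)).app G).hom w) := rfl
    have h2 (x : AugIdeal k G.obj) (u : (tpow (barP k) (n + 2)).obj G) :
        ((piPow k (n + 2)).app G).hom (mfAt G (n + 1) (tm x u)) = 0 := by
      induction u using tm_induction with
      | h0 => rw [tm_zero]; simp only [map_zero]
      | hadd a b ha hb => rw [tm_add, map_add, map_add, ha, hb, add_zero]
      | h y w =>
        rw [mfAt_succ, key, toAb_augMul]
        exact TensorProduct.zero_tmul _ _
    change ((piPow k (n + 2)).app G).hom (dAt G (n + 1) z) = 0
    induction z using tm_induction with
    | h0 => simp only [map_zero]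
    | hadd a b ha hb => simp only [map_add, ha, hb, add_zero]
    | h x u =>
      rw [dAt_succ, map_sub, map_neg, key]
      have h1 : ((piPow k (n + 1)).app G).hom (dAt G n u) = 0 :=
        DFunLike.congr_fun (congrArg (fun t => (t.app G).hom) ih) u
      rw [h1, h2, TensorProduct.tmul_zero, neg_zero]
      exact sub_zero _

instance : HasExt.{u + 1} (FGr k) := HasExt.standard _

/-- The class `[π^{⊗ (n+1)}] ∈ Ext^n(𝔞, 𝔞^{⊗ (n+1)})`. -/
def piClass (n : ℕ) : Abelian.Ext (ab k) (tpow (ab k) (n + 1)) n :=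
  (barResolution k).extMk (piPow k (n + 1)) (n + 1) rfl
    (by rw [show (barResolution k).complex.d (n + 1) n = barD k n from barComplex_d k n]; exact barD_piPow k n)
end Resolution

section ExteriorProduct

variable {k}

/-- A functor with flat values. -/
class PointwiseFlat (F : FGr k) : Prop where
  flat : ∀ G : Gr, Module.Flat k (F.obj G)

attribute [instance] PointwiseFlat.flat

instance : PointwiseFlat (ab k) where
  flat G := by
    have := G.property.1
    have e : Additive (Abelianization G.obj) ≃ₗ[ℤ]
        FreeAbelianGroup (IsFreeGroup.Generators G.obj) :=
      (MulEquiv.toAdditive (IsFreeGroup.toFreeGroup G.obj).abelianizationCongr).toIntLinearEquiv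
    have : Module.Free ℤ (Additive (Abelianization G.obj)) := Module.Free.of_equiv e.symm
    exact inferInstanceAs (Module.Flat k (k ⊗[ℤ] Additive (Abelianization G.obj)))

instance (F F' : FGr k) [PointwiseFlat F] [PointwiseFlat F'] : PointwiseFlat (F ⊗ F') where
  flat G := inferInstanceAs (Module.Flat k (F.obj G ⊗[k] F'.obj G))

instance : PointwiseFlat (𝟙_ (FGr k)) where
  flat _ := inferInstanceAs (Module.Flat k k)

instance pointwiseFlat_tpow (F : FGr k) [PointwiseFlat F] : (n : ℕ) → PointwiseFlat (tpow F n)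
  | 0 => inferInstanceAs (PointwiseFlat (𝟙_ (FGr k)))
  | 1 => inferInstanceAs (PointwiseFlat F)
  | n + 2 =>
    have := pointwiseFlat_tpow F (n + 1)
    inferInstanceAs (PointwiseFlat (F ⊗ tpow F (n + 1)))

instance : MonoidalPreadditive (FGr k) where
  whiskerLeft_zero := by intros; ext1; funext G; exact MonoidalPreadditive.whiskerLeft_zero
  zero_whiskerRight := by intros; ext1; funext G; exact MonoidalPreadditive.zero_whiskerRight
  whiskerLeft_add _ _ := by ext1; funext G; exact MonoidalPreadditive.whiskerLeft_add _ _
  add_whiskerRight _ _ := by ext1; funext G; exact MonoidalPreadditive.add_whiskerRight _ _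

instance (F : FGr k) [PointwiseFlat F] : PreservesFiniteLimits (tensorRight F) where
  preservesFiniteLimits J _ _ := preservesLimitsOfShape_of_evaluation _ _ fun G =>
    inferInstanceAs (PreservesLimitsOfShape J
      ((evaluation Gr (ModuleCat.{u} k)).obj G ⋙ tensorRight (F.obj G)))

instance (F : FGr k) [PointwiseFlat F] : PreservesFiniteLimits (tensorLeft F) where
  preservesFiniteLimits J _ _ := preservesLimitsOfShape_of_evaluation _ _ fun G =>
    inferInstanceAs (PreservesLimitsOfShape J
      ((evaluation Gr (ModuleCat.{u} k)).obj G ⋙ tensorLeft (F.obj G)))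

instance (F : FGr k) : PreservesFiniteColimits (tensorLeft F) where
  preservesFiniteColimits J _ _ := preservesColimitsOfShape_of_evaluation _ _ fun G =>
    inferInstanceAs (PreservesColimitsOfShape J
      ((evaluation Gr (ModuleCat.{u} k)).obj G ⋙ tensorLeft (F.obj G)))

instance (M : ModuleCat.{u} k) : PreservesFiniteColimits (tensorRight M) :=
  preservesFiniteColimits_of_natIso (BraidedCategory.tensorLeftIsoTensorRight M)

instance (F : FGr k) : PreservesFiniteColimits (tensorRight F) where
  preservesFiniteColimits J _ _ := preservesColimitsOfShape_of_evaluation _ _ fun G =>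
    inferInstanceAs (PreservesColimitsOfShape J
      ((evaluation Gr (ModuleCat.{u} k)).obj G ⋙ tensorRight (F.obj G)))

/-- The exterior product `Ext^p(F, G) ⊗ Ext^q(F', G') → Ext^{p+q}(F ⊗ F', G ⊗ G')`, the composite of
`x ⊗ F' ∈ Ext^p(F ⊗ F', G ⊗ F')` and `G ⊗ y ∈ Ext^q(G ⊗ F', G ⊗ G')`. Here `- ⊗ F'` and `G ⊗ -` are
exact since `F'` and `G` have flat values. -/
def exteriorProduct {F G F' G' : FGr k} [PointwiseFlat F'] [PointwiseFlat G] {p q n : ℕ}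
    (x : Abelian.Ext F G p) (y : Abelian.Ext F' G' q) (h : p + q = n) :
    Abelian.Ext (F ⊗ F') (G ⊗ G') n :=
  Abelian.Ext.comp (Y := G ⊗ F') (x.mapExactFunctor (tensorRight F')) (y.mapExactFunctor (tensorLeft G)) h

/-- The exterior product with the class of an identity is `x ⊗ F'`. -/
lemma exteriorProduct_mk₀_id {F G F' : FGr k} [PointwiseFlat F'] [PointwiseFlat G] {p : ℕ}
    (x : Abelian.Ext F G p) :
    exteriorProduct x (Abelian.Ext.mk₀ (𝟙 F')) (add_zero p) = x.mapExactFunctor (tensorRight F') := by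
  rw [exteriorProduct, Abelian.Ext.mapExactFunctor_mk₀, CategoryTheory.Functor.map_id]
  exact Abelian.Ext.comp_mk₀_id _

end ExteriorProduct
end GrFunctor

end

/-! The computation avoids any projective resolution of `𝔞^{⊗ n}`: the degree-one factor is treated
as an extension, and a Yoneda product with an extension is a connecting homomorphism.

Let `K = ker π`, so that `0 → K → P̄ → 𝔞 → 0` is exact. Exactness of the bar complex makes the
corestriction `δ : P̄ ⊗ P̄ → K` of the first differential a cokernel of the next one. Since `π ⊗ π`
is a cocycle, it factors as `g ∘ δ` with `g : K → 𝔞 ⊗ 𝔞`; concretely `g(xy) = -[x] ⊗ [y]`. Hence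
`[π^{⊗ 2}]` is minus the pushout along `g` of the class of this extension (`piClass_one`); the minus
sign comes from the sign convention for mapping cone triangles (`extClass_eq_neg_extMk`).

Put `T = 𝔞^{⊗ (n-1)}`. Its values are flat, so tensoring with `T` gives a short exact sequence `0 →
K ⊗ T → P̄ ⊗ T → 𝔞 ⊗ T → 0`, and `[π^{⊗ 2}] ⊗ [Id]` is minus the pushout of its class along `g ⊗ T`.
By `yonedaProduct_extClass`, the product of the class of a cocycle `f` with an extension class is
minus the class of the cocycle obtained by lifting `f` to the middle term, composing with the
differential and corestricting to the subobject. The two minus signs cancel.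

For `f = π^{⊗ n}` the lift is `P̄ ⊗ π^{⊗ (n-1)}`. The bar differential is a term acting on the first
two factors plus a term `-(P̄ ⊗ d)`; the latter dies because `π^{⊗ (n-1)} ∘ d = 0`. What remains is
`δ ⊗ π^{⊗ (n-1)}`, and applying `g` to its first factor gives `π ⊗ π ⊗ π^{⊗ (n-1)} = π^{⊗ (n+1)}`.
-/

noncomputable section
namespace GrFunctor
universe w v u

/-! ### Truncated complexes, and extension classes in terms of cocycles. -/

section ExtClass
open CochainComplex CochainComplex.HomComplex Abelian DerivedCategory

variable {C : Type u} [Category.{v} C] [Abelian C]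

/-- The truncation of a chain complex in degrees at least `p`, shifted by `p`. -/
def shiftedTruncation (K : ChainComplex C ℕ) (p : ℕ) : ChainComplex C ℕ :=
  ChainComplex.of (fun n => K.X (p + n)) (fun n => K.d (p + (n + 1)) (p + n))
    (fun _ => K.d_comp_d _ _ _)

lemma shiftedTruncation_d (K : ChainComplex C ℕ) (p n : ℕ) :
    (shiftedTruncation K p).d (n + 1) n = K.d (p + (n + 1)) (p + n) := by
  simp [shiftedTruncation]

/-- The augmentation of the truncation. -/
def shiftedTruncationπ (K : ChainComplex C ℕ) (p : ℕ) :
    shiftedTruncation K p ⟶ (ChainComplex.single₀ C).obj (cokernel (K.d (p + 1) p)) :=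
  (ChainComplex.toSingle₀Equiv _ _).symm ⟨cokernel.π (K.d (p + 1) p), by
    rw [shiftedTruncation_d]; exact cokernel.condition _⟩

lemma shiftedTruncationπ_f_zero (K : ChainComplex C ℕ) (p : ℕ) :
    (shiftedTruncationπ K p).f 0 = cokernel.π (K.d (p + 1) p) :=
  ChainComplex.toSingle₀Equiv_symm_apply_f_zero (C := shiftedTruncation K p)
    (cokernel.π (K.d (p + 1) p)) _

/-- The third morphism of the standard triangle is minus the first projection of the cone. This is
the only source of the sign in `extClass_eq_neg_extMk`. -/
lemma comp_triangle_mor₃ {K L M : CochainComplex C ℤ} (φ : K ⟶ L) (w : M ⟶ mappingCone φ) :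
    w ≫ (mappingCone.triangle φ).mor₃ =
      -(Cocycle.equivHomShift.symm ((mappingCone.fst φ).precomp w) : M ⟶ K⟦(1 : ℤ)⟧) := by
  rw [Cocycle.equivHomShift_symm_precomp, ← Preadditive.comp_neg, ← map_neg]
  rfl

/-- The connecting morphism is defined by inverting the quasi-isomorphism from the cone to `T.X₃`.
If another quasi-isomorphism `π` onto `T.X₃` factors through the cone by `w`, then inverting `π`
does as well, and only the composite of `w` with the third morphism of the triangle matters. -/
lemma triangleOfSESδ_eq_of_lift [HasDerivedCategory.{w} C] {T : ShortComplex (CochainComplex C ℤ)}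
    (hT : T.ShortExact) {K : CochainComplex C ℤ} (π : K ⟶ T.X₃) (hπ : QuasiIso π)
    (w : K ⟶ mappingCone T.f) (hw : w ≫ mappingCone.descShortComplex T = π)
    (α : Cocycle K T.X₁ 1)
    (hα : w ≫ (mappingCone.triangle T.f).mor₃ =
      -(Cocycle.equivHomShift.symm α : K ⟶ T.X₁⟦(1 : ℤ)⟧)) :
    triangleOfSESδ hT =
      -(inv (Q.map π) ≫ ShiftedHom.map (Cocycle.equivHomShift.symm α : K ⟶ T.X₁⟦(1 : ℤ)⟧) Q) := by
  rw [← Preadditive.comp_neg, IsIso.eq_inv_comp, ← hw, Functor.map_comp, Category.assoc,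
    ShiftedHom.map, ← Preadditive.neg_comp, ← Functor.map_neg, ← hα]
  exact (congrArg _ (descShortComplex_triangleOfSESδ hT)).trans (Q.map_comp_assoc _ _ _).symm

variable {S : ShortComplex C} (R : ProjectiveResolution S.X₃)

/-- A lift of the augmentation to the mapping cone of `A ⟶ B`, for an extension
`0 → A → B → C → 0` and a projective resolution of `C`. -/
lemma exists_lift_mappingCone (σ : R.complex.X 0 ⟶ S.X₂) (hσ : σ ≫ S.g = R.π.f 0)
    (g : R.complex.X 1 ⟶ S.X₁) (hg : g ≫ S.f = R.complex.d 1 0 ≫ σ)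
    (α : Cocycle R.cochainComplex ((CochainComplex.singleFunctor C 0).obj S.X₁) 1)
    (hα : α.1 = Cochain.toSingleMk ((R.cochainComplexXIso (-1) 1 rfl).hom ≫ g) (by simp)) :
    ∃ w : R.cochainComplex ⟶ mappingCone ((CochainComplex.singleFunctor C 0).map S.f),
      w ≫ mappingCone.descShortComplex (S.map (CochainComplex.singleFunctor C 0)) = R.π' ∧
      w ≫ (mappingCone.triangle ((CochainComplex.singleFunctor C 0).map S.f)).mor₃ =
        -Cocycle.equivHomShift.symm α := by
  -- This is the condition for `α` and `σ` to be the two components of a morphism to the cone. The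
  -- coboundary of `σ` is `-(d ≫ σ)`, so the condition is exactly `hg`, with no sign to insert in
  -- `α`.
  have e : δ 0 1 (Cochain.toSingleMk ((R.cochainComplexXIso 0 0 rfl).hom ≫ σ) (zero_add 0)) +
      α.1.comp (Cochain.ofHom ((CochainComplex.singleFunctor C 0).map S.f)) (add_zero 1) = 0 := by
    rw [hα, Cochain.δ_toSingleMk _ _ _ (-1) (by simp), R.cochainComplex_d (-1) 0 1 0,
      ← Cochain.toSingleMk_postcomp]
    simp [hg]
  refine ⟨mappingCone.lift _ α (Cochain.toSingleMk ((R.cochainComplexXIso 0 0 rfl).hom ≫ σ)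
    (zero_add 0)) e, ?_, ?_⟩
  -- A morphism to a complex concentrated in degree `0` is determined there, where the composite is
  -- `σ ≫ S.g`.
  · apply HomologicalComplex.to_single_hom_ext
    refine (mappingCone.lift_desc_f _ _ _ e 0 ((CochainComplex.singleFunctor C 0).map S.g)
      (by simp [← Functor.map_comp]) 0 1 (by simp)).trans ?_
    rw [Cochain.zero_v, comp_zero, zero_add, Cochain.toSingleMk_v,
      ProjectiveResolution.π'_f_zero, ← hσ]
    simp [CochainComplex.singleFunctor, CochainComplex.singleFunctors,
      HomologicalComplex.single_map_f_self]
  · rw [comp_triangle_mor₃]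
    congr 2
    ext1
    exact mappingCone.lift_fst _ _ _ e

variable [HasExt.{w} C]

/-- Both sides are compared in the derived category: each is a morphism between single complexes,
conjugated by the identification of objects with the images of single complexes under `Q`, and
`triangleOfSESδ_eq_of_lift` matches what is in between. -/
lemma extClass_eq_neg_of_lift (hS : S.ShortExact)
    (α : Cocycle R.cochainComplex ((CochainComplex.singleFunctor C 0).obj S.X₁) 1)
    (w : R.cochainComplex ⟶ mappingCone ((CochainComplex.singleFunctor C 0).map S.f))
    (hw : w ≫ mappingCone.descShortComplex (S.map (CochainComplex.singleFunctor C 0)) = R.π')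
    (hα : w ≫ (mappingCone.triangle ((CochainComplex.singleFunctor C 0).map S.f)).mor₃ =
      -Cocycle.equivHomShift.symm α) :
    hS.extClass = -R.extEquivCohomologyClass.symm (.mk (n := 1) α) := by
  have := HasDerivedCategory.standard C
  ext
  rw [Ext.neg_hom, ShortComplex.ShortExact.extClass_hom]
  refine Eq.trans ?_ (congrArg Neg.neg
    (R.extEquivCohomologyClass_symm_mk_hom (n := 1) α)).symm
  have e := triangleOfSESδ_eq_of_lift (hS.map_of_exact (HomologicalComplex.single C _ 0)) R.π'
    (inferInstanceAs (QuasiIso R.π')) w hw α hα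
  have assoc {V W X Y Z : DerivedCategory C} (a : V ⟶ W) (b : W ⟶ X)
      (c : X ⟶ Y) (d : Y ⟶ Z) : a ≫ (-(b ≫ c)) ≫ d = -((a ≫ b) ≫ c ≫ d) := by simp
  rw [ShiftedHom.mk₀_comp, ShiftedHom.comp_mk₀, ShortComplex.ShortExact.singleδ, e]
  -- The connecting morphism and the class of a cocycle refer to this identification through two
  -- different isomorphisms, which have the same components.
  have h₁ (X : C) : ((SingleFunctors.evaluation C (DerivedCategory C) 0).mapIso
      (singleFunctorsPostcompQIso C)).hom.app X = (singleFunctorIsoCompQ C 0).hom.app X := by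
    rw [Functor.mapIso_hom, SingleFunctors.evaluation_map, singleFunctorsPostcompQIso_hom_hom]
    rfl
  have h₂ (X : C) : ((SingleFunctors.evaluation C (DerivedCategory C) 0).mapIso
      (singleFunctorsPostcompQIso C)).inv.app X = (singleFunctorIsoCompQ C 0).inv.app X := by
    rw [Functor.mapIso_inv, SingleFunctors.evaluation_map, singleFunctorsPostcompQIso_inv_hom]
    rfl
  rw [h₁, h₂]
  exact assoc _ _ _ _

/-- The class of an extension `0 → A → B → C → 0` in terms of a projective resolution of `C`. -/
lemma extClass_eq_neg_extMk (hS : S.ShortExact) (σ : R.complex.X 0 ⟶ S.X₂)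
    (hσ : σ ≫ S.g = R.π.f 0)
    (g : R.complex.X 1 ⟶ S.X₁) (hg : g ≫ S.f = R.complex.d 1 0 ≫ σ)
    (hg' : R.complex.d 2 1 ≫ g = 0) :
    hS.extClass = -R.extMk g 2 rfl hg' := by
  obtain ⟨w, hw₁, hw₂⟩ := exists_lift_mappingCone R σ hσ g hg
    (Cocycle.toSingleMk ((R.cochainComplexXIso (-1) 1 rfl).hom ≫ g) (by simp)
      (-2) (by lia) (by simpa [R.cochainComplex_d (-2) (-1) 2 1 rfl rfl])) rfl
  exact extClass_eq_neg_of_lift R hS _ w hw₁ hw₂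

/-! ### Yoneda products with extension classes. -/

/-- The truncation of a projective resolution, which resolves a cokernel of its differential. -/
def truncateResolution {X : C} (T : ProjectiveResolution X) (p : ℕ) :
    ProjectiveResolution (cokernel (T.complex.d (p + 1) p)) where
  complex := shiftedTruncation T.complex p
  projective n := inferInstanceAs (Projective (T.complex.X (p + n)))
  π := shiftedTruncationπ T.complex p
  quasiIso := ⟨fun n => by
    cases n with
    | zero =>
      rw [ChainComplex.quasiIsoAt₀_iff, ShortComplex.quasiIso_iff_of_zeros' _ rfl rfl rfl]
      refine (ShortComplex.exact_and_epi_g_iff_of_iso ?_).2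
        ⟨ShortComplex.exact_cokernel (T.complex.d (p + 1) p),
          inferInstanceAs (Epi (cokernel.π (T.complex.d (p + 1) p)))⟩
      exact ShortComplex.isoMk (Iso.refl _) (Iso.refl _) (Iso.refl _)
        ((Category.id_comp _).trans ((shiftedTruncation_d _ _ _).symm.trans
          (Category.comp_id _).symm))
        ((Category.id_comp _).trans ((shiftedTruncationπ_f_zero T.complex p).symm.trans
          (Category.comp_id _).symm))
    | succ n =>
      rw [quasiIsoAt_iff_exactAt' (hL := ChainComplex.exactAt_succ_single_obj ..),
        HomologicalComplex.exactAt_iff' _ (n + 1 + 1) (n + 1) n (by simp) (by simp)]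
      refine (ShortComplex.exact_iff_of_iso ?_).2 (T.exact_succ (p + n))
      exact ShortComplex.isoMk (Iso.refl _) (Iso.refl _) (Iso.refl _)
        ((Category.id_comp _).trans ((shiftedTruncation_d T.complex p (n + 1)).symm.trans
          (Category.comp_id _).symm))
        ((Category.id_comp _).trans ((shiftedTruncation_d T.complex p n).symm.trans
          (Category.comp_id _).symm))⟩

lemma zsmul_comp {Y Z W : C} {a b c : ℕ} (n : ℤ) (x : Ext Y Z a) (y : Ext Z W b)
    (h : a + b = c) : (n • x).comp y h = n • x.comp y h :=
  map_zsmul (y.postcomp Y h) n x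

/-- The Yoneda product with the class of an extension is minus the connecting homomorphism. -/
lemma yonedaProduct_extClass {X : C} (T : ProjectiveResolution X)
    (hS : S.ShortExact) {p : ℕ} (f : T.complex.X p ⟶ S.X₃)
    (hf : T.complex.d (p + 1) p ≫ f = 0) (φ : T.complex.X p ⟶ S.X₂) (hφ : φ ≫ S.g = f)
    (ψ : T.complex.X (p + 1) ⟶ S.X₁) (hψ : ψ ≫ S.f = T.complex.d (p + 1) p ≫ φ)
    (hψ' : T.complex.d (p + 2) (p + 1) ≫ ψ = 0) :
    yonedaProduct (T.extMk f (p + 1) rfl hf) hS.extClass rfl = -T.extMk ψ (p + 2) rfl hψ' := by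
  let R := truncateResolution T p
  have hRd (n : ℕ) : R.complex.d (n + 1) n = T.complex.d (p + (n + 1)) (p + n) :=
    shiftedTruncation_d _ _ _
  have hRπ : R.π.f 0 = cokernel.π (T.complex.d (p + 1) p) :=
    shiftedTruncationπ_f_zero T.complex p
  have := hS.mono_f
  -- The universal case: every cocycle `f` on `T_p` factors through `c`, and `f` with its lift `φ`
  -- gives a morphism `τ` to `S` from the extension `0 → ker c → T_p → coker d → 0`. It suffices to
  -- compute for that extension and push forward along `ψ'`.
  let c := cokernel.π (T.complex.d (p + 1) p)
  let f' : cokernel (T.complex.d (p + 1) p) ⟶ S.X₃ := cokernel.desc _ f hf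
  let κ : T.complex.X (p + 1) ⟶ kernel c := kernel.lift c (T.complex.d (p + 1) p) (by simp [c])
  let S' : ShortComplex C := ShortComplex.mk (kernel.ι c) c (by simp)
  have hS' : S'.ShortExact :=
    { exact := ShortComplex.exact_of_f_is_kernel _ (kernelIsKernel c)
      mono_f := inferInstanceAs (Mono (kernel.ι c))
      epi_g := inferInstanceAs (Epi c) }
  have hcf : c ≫ f' = φ ≫ S.g := by simp [c, f', hφ]
  -- On `ker c` the composite of `φ` with `S.g` vanishes since it factors through `c`, so `φ`
  -- restricts to a map into the subobject `S.X₁`.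
  let ψ' : kernel c ⟶ S.X₁ := hS.exact.lift (kernel.ι c ≫ φ) (by
    rw [Category.assoc, ← hcf, kernel.condition_assoc, zero_comp])
  have hψ'f : ψ' ≫ S.f = kernel.ι c ≫ φ := hS.exact.lift_f _ _
  have hκ : κ ≫ ψ' = ψ := by
    rw [← cancel_mono S.f, Category.assoc, hψ'f, hψ, kernel.lift_ι_assoc]
  let τ : S' ⟶ S := { τ₁ := ψ', τ₂ := φ, τ₃ := f', comm₁₂ := hψ'f, comm₂₃ := hcf.symm }
  have hκd : T.complex.d (p + 2) (p + 1) ≫ κ = 0 := by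
    rw [← cancel_mono (kernel.ι c), Category.assoc, kernel.lift_ι, zero_comp]
    exact T.complex.d_comp_d _ _ _
  -- The middle term of `S'` is the degree `0` term of `R`, so the identity lifts the augmentation
  -- and the associated cocycle is the corestricted differential `κ`.
  have e₁ : hS'.extClass = -R.extMk κ 2 rfl (by rw [hRd]; exact hκd) := by
    refine extClass_eq_neg_extMk (S := S') R hS' (𝟙 _) ?_ κ ?_ _
    · exact (Category.id_comp _).trans hRπ.symm
    · rw [hRd]
      exact (kernel.lift_ι _ _ _).trans (Category.comp_id _).symm
  have e₂ : T.extMk f (p + 1) rfl hf =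
      (T.extMk c (p + 1) rfl (cokernel.condition _)).comp (Ext.mk₀ f') (add_zero p) := by
    rw [ProjectiveResolution.extMk_comp_mk₀]
    congr 1
    simp [c, f']
  -- The truncation keeps the terms and the differentials of `T` without any sign, so the identities
  -- form a lift of `c` in the required sense.
  have e₃ := yonedaProduct_extMk T R (p := p) (q := 1) c (cokernel.condition _) κ
    (by rw [hRd]; exact hκd) (fun n => 𝟙 (T.complex.X (p + n)))
    ((Category.id_comp _).trans hRπ)
    (fun n => by rw [hRd]; exact (Category.comp_id _).trans (Category.id_comp _).symm)
  -- Pulling the class of `S` back along `f'` equals pushing the class of `S'` forward along `ψ'`.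
  -- Associativity then moves `f'` from the first factor to the second, and `ψ'` out of the product.
  have e₄ := ShortComplex.ShortExact.extClass_naturality hS' hS τ
  rw [yonedaProduct] at e₃ ⊢
  have e₅ := congrArg (fun x => Ext.comp x (Ext.mk₀ ψ') (add_zero (p + 1))) e₃
  rw [zsmul_comp, ProjectiveResolution.extMk_comp_mk₀, Ext.comp_assoc_of_third_deg_zero] at e₅
  rw [e₂, Ext.comp_assoc_of_second_deg_zero, ← e₄, e₁, Ext.neg_comp, Ext.comp_neg, smul_neg]
  refine (congrArg _ e₅).trans ?_
  congr 2
  exact (congrArg (· ≫ ψ') (Category.id_comp κ)).trans hκ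

/-- The Yoneda product with minus the pushout of the class of an extension. -/
lemma yonedaProduct_neg_extClass_comp {X Z : C} (T : ProjectiveResolution X)
    (hS : S.ShortExact) {p : ℕ} (f : T.complex.X p ⟶ S.X₃)
    (hf : T.complex.d (p + 1) p ≫ f = 0) (φ : T.complex.X p ⟶ S.X₂) (hφ : φ ≫ S.g = f)
    (ψ : T.complex.X (p + 1) ⟶ S.X₁) (hψ : ψ ≫ S.f = T.complex.d (p + 1) p ≫ φ)
    (e : S.X₁ ⟶ Z) (t : T.complex.X (p + 1) ⟶ Z) (ht : ψ ≫ e = t)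
    (htd : T.complex.d (p + 2) (p + 1) ≫ t = 0) :
    yonedaProduct (T.extMk f (p + 1) rfl hf) (-hS.extClass.comp (Ext.mk₀ e) (add_zero 1)) rfl =
      T.extMk t (p + 2) rfl htd := by
  have := hS.mono_f
  have hψ' : T.complex.d (p + 2) (p + 1) ≫ ψ = 0 := by
    rw [← cancel_mono S.f, Category.assoc, hψ, T.complex.d_comp_d_assoc, zero_comp, zero_comp]
  have e₁ := congrArg (fun x => Ext.comp x (Ext.mk₀ e) (add_zero (p + 1)))
    (yonedaProduct_extClass T hS f hf φ hφ ψ hψ hψ')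
  rw [yonedaProduct, zsmul_comp, Ext.neg_comp, ProjectiveResolution.extMk_comp_mk₀,
    Ext.comp_assoc_of_third_deg_zero] at e₁
  -- The sign of the connecting homomorphism cancels the sign in front of the extension class.
  rw [yonedaProduct, Ext.comp_neg, smul_neg, e₁, neg_neg]
  simp only [ht]

lemma comp_mk₀_comp_mk₀ {X Y Z W : C} {n : ℕ} (x : Ext X Y n) (a : Y ⟶ Z) (b : Z ⟶ W) :
    (x.comp (Ext.mk₀ a) (add_zero n)).comp (Ext.mk₀ b) (add_zero n) =
      x.comp (Ext.mk₀ (a ≫ b)) (add_zero n) := by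
  rw [Ext.comp_assoc_of_third_deg_zero, Ext.mk₀_comp_mk₀]

end ExtClass
-- Identities in a monoidal category.
section Monoidal

variable {C : Type u} [Category.{v} C] [MonoidalCategory C] {P Q T K A : C}

lemma associator_inv_tensorHom_comp_whiskerRight (κ : P ⊗ P ⟶ K) (p : Q ⟶ T) (ι : K ⟶ A) :
    ((α_ P P Q).inv ≫ (κ ⊗ₘ p)) ≫ ι ▷ T = (α_ P P Q).inv ≫ (κ ≫ ι ⊗ₘ p) := by
  rw [Category.assoc, ← tensorHom_id, tensorHom_comp_tensorHom, Category.comp_id]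

/-- With `κ` the corestricted differential, this evaluates the final cocycle: `g` turns `κ` into `π
⊗ π`, and naturality cancels the two associators. -/
lemma associator_inv_tensorHom_comp_associator (κ : P ⊗ P ⟶ K) (p : Q ⟶ T) (π : P ⟶ A)
    (g : K ⟶ A ⊗ A) (hg : κ ≫ g = π ⊗ₘ π) :
    ((α_ P P Q).inv ≫ (κ ⊗ₘ p)) ≫ g ▷ T ≫ (α_ A A T).hom = π ⊗ₘ (π ⊗ₘ p) := by
  rw [← Category.assoc, associator_inv_tensorHom_comp_whiskerRight, hg, Category.assoc,
    associator_naturality, Iso.inv_hom_id_assoc]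

/-- The first factor on the left has the recursive shape of the bar differential. Its inner part `P
◁ D` is killed since `D ≫ p = 0`; only the product of the first two factors survives, and its sign
is absorbed into `-μ`. -/
lemma neg_sub_whiskerLeft_comp_whiskerLeft [Preadditive C] [MonoidalPreadditive C]
    (μ : P ⊗ P ⟶ P) (D : P ⊗ Q ⟶ Q) (p : Q ⟶ T) (h : D ≫ p = 0) :
    (-((α_ P P Q).inv ≫ μ ▷ Q) - P ◁ D) ≫ P ◁ p = (α_ P P Q).inv ≫ (-μ ⊗ₘ p) := by
  have h₁ : (-μ) ⊗ₘ p = -(μ ⊗ₘ p) := by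
    rw [MonoidalCategory.tensorHom_def, MonoidalCategory.tensorHom_def, ← Preadditive.neg_comp]
    exact congrArg (· ≫ _) ((tensorRight Q).map_neg (f := μ))
  rw [Preadditive.sub_comp, ← MonoidalCategory.whiskerLeft_comp, h,
    MonoidalPreadditive.whiskerLeft_zero, sub_zero, Preadditive.neg_comp, h₁,
    Preadditive.comp_neg, Category.assoc,
    MonoidalCategory.tensorHom_def]

end Monoidal

/-! ### The extension defined by `π`, and the product formula. -/

section Main
open Abelian

variable (k : Type u) [CommRing k]

/-- The corestriction of `barD k 0` to the kernel of `π`. -/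
def barDToKernel : tpow (barP k) 2 ⟶ kernel (barPToAb k) :=
  kernel.lift _ (barD k 0) (barD_comp_pi k)

lemma barDToKernel_ι : barDToKernel k ≫ kernel.ι (barPToAb k) = barD k 0 := kernel.lift_ι _ _ _

lemma barD_comp_barDToKernel : barD k 1 ≫ barDToKernel k = 0 := by
  rw [← cancel_mono (kernel.ι (barPToAb k)), Category.assoc, barDToKernel_ι, zero_comp]
  exact barD_comp k 0

/-- Composing the second map with the monomorphism `ker π → P̄` does not affect exactness, and the
result is the bar complex at `P̄^{⊗ 2}`. -/
lemma exact_barDToKernel : (ShortComplex.mk _ _ (barD_comp_barDToKernel k)).Exact := by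
  let φ : ShortComplex.mk _ _ (barD_comp_barDToKernel k) ⟶ ShortComplex.mk _ _ (barD_comp k 0) :=
    { τ₁ := 𝟙 _, τ₂ := 𝟙 _, τ₃ := kernel.ι (barPToAb k)
      comm₂₃ := (Category.id_comp _).trans (barDToKernel_ι k).symm }
  have : Epi φ.τ₁ := inferInstanceAs (Epi (𝟙 _))
  have : IsIso φ.τ₂ := inferInstanceAs (IsIso (𝟙 _))
  have : Mono φ.τ₃ := inferInstanceAs (Mono (kernel.ι (barPToAb k)))
  exact (ShortComplex.exact_iff_of_epi_of_isIso_of_mono φ).2 (exact_barD k 0)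

instance : Epi (barDToKernel k) := (exact_barD_pi k).epi_kernelLift

/-- By exactness and surjectivity, `barDToKernel k` is a cokernel of `barD k 1`, which the cocycle
`π ⊗ π` annihilates. -/
lemma exists_barDToKernel_comp :
    ∃ g : kernel (barPToAb k) ⟶ tpow (ab k) 2, barDToKernel k ≫ g = piPow k 2 :=
  have : Epi (ShortComplex.mk _ _ (barD_comp_barDToKernel k)).g :=
    inferInstanceAs (Epi (barDToKernel k))
  ⟨(exact_barDToKernel k).desc (piPow k 2) (barD_piPow k 1), (exact_barDToKernel k).g_desc _ _⟩

/-- The extension `0 → ker π → P̄ → 𝔞 → 0`. -/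
abbrev piShortComplex : ShortComplex (FGr k) :=
  ShortComplex.mk (kernel.ι (barPToAb k)) (barPToAb k) (kernel.condition _)

lemma piShortComplex_shortExact : (piShortComplex k).ShortExact where
  exact := ShortComplex.exact_of_f_is_kernel _ (kernelIsKernel _)
  mono_f := inferInstanceAs (Mono (kernel.ι _))
  epi_g := inferInstanceAs (Epi (barPToAb k))

lemma barResolution_d (n : ℕ) : (barResolution k).complex.d (n + 1) n = barD k n :=
  barComplex_d k n

lemma extClass_piShortComplex : (piShortComplex_shortExact k).extClass =
    -(barResolution k).extMk (barDToKernel k) 2 rfl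
      (by rw [barResolution_d]; exact barD_comp_barDToKernel k) := by
  refine extClass_eq_neg_extMk (S := piShortComplex k) (barResolution k) _ (𝟙 _) ?_
    (barDToKernel k) ?_ _
  · exact (Category.id_comp _).trans (barAug_f_zero k).symm
  · rw [barResolution_d]
    exact (barDToKernel_ι k).trans (Category.comp_id _).symm

/-- The extension class is minus the class of the cocycle `barDToKernel k`, and pushing that cocycle
forward along `g` gives `π ⊗ π`. -/
lemma piClass_one (g : kernel (barPToAb k) ⟶ tpow (ab k) 2) (hg : barDToKernel k ≫ g = piPow k 2) :
    piClass k 1 = -((piShortComplex_shortExact k).extClass.comp (Ext.mk₀ g) (add_zero 1)) := by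
  rw [extClass_piShortComplex, Ext.neg_comp, neg_neg]
  refine Eq.trans ?_ (ProjectiveResolution.extMk_comp_mk₀ ..).symm
  simp only [piClass, ← hg]
  rfl

/-- On elements both sides are `x ⊗ y ⊗ u ↦ -xy ⊗ π^{⊗ (m+1)}(u)`: the terms of the differential
that multiply within `y ⊗ u` vanish after applying `π^{⊗ (m+1)}`. -/
lemma barD_comp_whiskerLeft_piPow (m : ℕ) :
    barD k (m + 1) ≫ barP k ◁ piPow k (m + 1) =
      (α_ (barP k) (barP k) (tpow (barP k) (m + 1))).inv ≫ (barD k 0 ⊗ₘ piPow k (m + 1)) := by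
  exact neg_sub_whiskerLeft_comp_whiskerLeft (barPMul k) (barD k m) (piPow k (m + 1))
    (barD_piPow k m)

/-- The Yoneda product of `[π^{⊗ n}]` and `[π^{⊗ 2}] ⊗ [Id]` is `[π^{⊗ (n+1)}]`, for `n = m + 2`. -/
theorem yonedaProduct_piClass_exteriorProduct (m : ℕ) :
    yonedaProduct (piClass k (m + 1))
      ((exteriorProduct (piClass k 1)
          (Abelian.Ext.mk₀ (𝟙 (tpow (ab k) (m + 1)))) (add_zero 1)).comp
        (Abelian.Ext.mk₀
          (α_ (ab k) (ab k) (tpow (ab k) (m + 1))).hom)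
        (add_zero 1)) rfl =
    piClass k (m + 2) := by
  obtain ⟨g, hg⟩ := exists_barDToKernel_comp k
  let T := tpow (ab k) (m + 1)
  -- Exactness of `- ⊗ T` rests on the flatness of the values of `𝔞`, hence of `T`.
  let hS := (piShortComplex_shortExact k).map_of_exact (tensorRight T)
  let e : (kernel (barPToAb k)) ⊗ T ⟶ tpow (ab k) (m + 3) :=
    g ▷ T ≫ (α_ (ab k) (ab k) T).hom
  -- The corestriction to `ker π ⊗ T` of the differential followed by the lift `P̄ ⊗ π^{⊗ (m+1)}` of
  -- `π^{⊗ (m+2)}`.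
  let ψ : tpow (barP k) (m + 3) ⟶ kernel (barPToAb k) ⊗ T :=
    (α_ (barP k) (barP k) (tpow (barP k) (m + 1))).inv ≫ (barDToKernel k ⊗ₘ piPow k (m + 1))
  have hψ : ψ ≫ kernel.ι (barPToAb k) ▷ T = barD k (m + 1) ≫ barP k ◁ piPow k (m + 1) := by
    rw [barD_comp_whiskerLeft_piPow, ← barDToKernel_ι]
    exact associator_inv_tensorHom_comp_whiskerRight _ _ _
  have hψe : ψ ≫ e = piPow k (m + 3) :=
    associator_inv_tensorHom_comp_associator (barDToKernel k) (piPow k (m + 1)) (barPToAb k) g hg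
  have e₁ : (exteriorProduct (piClass k 1) (Ext.mk₀ (𝟙 T)) (add_zero 1)).comp
      (Ext.mk₀ (α_ (ab k) (ab k) T).hom) (add_zero 1) =
      -(hS.extClass.comp (Ext.mk₀ e) (add_zero 1)) := by
    rw [exteriorProduct_mk₀_id, piClass_one k g hg]
    -- The map induced by `- ⊗ T` on `Ext` is additive, so it carries the minus sign of
    -- `piClass_one` through.
    have h₁ := (Functor.mapExtAddHom (tensorRight T) (ab k) (tpow (ab k) 2) 1).map_neg
      ((piShortComplex_shortExact k).extClass.comp (Ext.mk₀ g) (add_zero 1))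
    have h₂ : ((piShortComplex_shortExact k).extClass.comp (Ext.mk₀ g)
        (add_zero 1)).mapExactFunctor (tensorRight T) =
          hS.extClass.comp (Ext.mk₀ (g ▷ T)) (add_zero 1) := by
      rw [Ext.mapExactFunctor_comp, Ext.mapExactFunctor_extClass, Ext.mapExactFunctor_mk₀]
      rfl
    rw [Functor.mapExtAddHom_apply, Functor.mapExtAddHom_apply, h₂] at h₁
    refine (congrArg (fun x => Ext.comp x _ _) h₁).trans ?_
    refine (Ext.neg_comp _ _ _).trans (congrArg _ ?_)
    exact comp_mk₀_comp_mk₀ _ _ _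
  refine (congrArg (fun x => yonedaProduct (piClass k (m + 1)) x rfl) e₁).trans ?_
  -- The chosen lift is valid since `π ⊗ π^{⊗ (m+1)}` factors as `P̄ ⊗ π^{⊗ (m+1)}` followed by `π ⊗
  -- T`.
  exact yonedaProduct_neg_extClass_comp (barResolution k) hS (p := m + 1) (piPow k (m + 2))
    (by rw [barResolution_d]; exact barD_piPow k (m + 1)) (barP k ◁ piPow k (m + 1))
    ((tensorHom_def' _ _).symm) ψ (by rw [barResolution_d]; exact hψ) e (piPow k (m + 3)) hψe
    (by rw [barResolution_d]; exact barD_piPow k (m + 2))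

end Main
end GrFunctor

end

/-- For `n = m + 2 ≥ 2`, the Yoneda product of `[π^{⊗ n}] ∈ Ext^{n-1}(𝔞, 𝔞^{⊗ n})` and
`[π^{⊗ 2}] ⊗ [Id_{𝔞^{⊗ (n-1)}}] ∈ Ext^1(𝔞 ⊗ 𝔞^{⊗ (n-1)}, (𝔞 ⊗ 𝔞) ⊗ 𝔞^{⊗ (n-1)})`, the target being
identified with `𝔞^{⊗ (n+1)}` by the associator, is `[π^{⊗ (n+1)}]`. -/
theorem mainTheorem11 (k : Type*) [CommRing k] (m : ℕ) :
    GrFunctor.yonedaProduct (GrFunctor.piClass k (m + 1))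
      ((GrFunctor.exteriorProduct (GrFunctor.piClass k 1)
          (Abelian.Ext.mk₀ (𝟙 (GrFunctor.tpow (GrFunctor.ab k) (m + 1)))) (add_zero 1)).comp
        (Abelian.Ext.mk₀
          (α_ (GrFunctor.ab k) (GrFunctor.ab k) (GrFunctor.tpow (GrFunctor.ab k) (m + 1))).hom)
        (add_zero 1)) rfl =
    GrFunctor.piClass k (m + 2) := by
  exact GrFunctor.yonedaProduct_piClass_exteriorProduct k m
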